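/- Let $k$ be an algebraically closed field of characteristic $0$, let $E$ be an elliptic curve over $k$, and let $K=k(E)$ be its field of rational functions. Let $B_2(K)$ be the pre-Bloch group of $K$, that is, the quotient of the free abelian group $\mathbb Z[K\setminus\{0,1\}]$ on the symbols $[f]$, $f\in K\setminus\{0,1\}$, by the subgroup generated by the Abel five-term elements $$[x]-[y]+\left[\frac yx\right]+\left[\frac{1-x}{1-y}\right]-\left[\frac{1-x^{-1}}{1-y^{-1}}\right],\qquad x,y\in K\setminus\{0,1\},\ x\neq y.$$ For a non-zero $f\in K$ let $\deg f$ be the number of zeros of $f$ on $E$, counted with multiplicities (so $\deg f=0$ for non-zero constants). Then $B_2(K)$ is generated, as an abelian group, by the classes $[f]$ with $f\in K\setminus\{0,1\}$ and $\deg f\le 3$. -/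

import Mathlib

/-! ### The pre-Bloch group of a field -/

namespace PreBloch

/-- The set `K \ {0, 1}`. -/
abbrev Gen (K : Type*) [Field K] : Type _ := {f : K // f ≠ 0 ∧ f ≠ 1}

variable {K : Type*} [Field K]

/-- The element `y / x` of `K \ {0, 1}`. -/
def arg₁ (x y : Gen K) (h : x ≠ y) : Gen K :=
  ⟨y.1 / x.1, div_ne_zero y.2.1 x.2.1, fun e =>
    h (Subtype.ext ((div_eq_one_iff_eq x.2.1).1 e).symm)⟩

/-- The element `(1 - x) / (1 - y)` of `K \ {0, 1}`. -/
def arg₂ (x y : Gen K) (h : x ≠ y) : Gen K :=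
  ⟨(1 - x.1) / (1 - y.1),
    div_ne_zero (sub_ne_zero.2 x.2.2.symm) (sub_ne_zero.2 y.2.2.symm), fun e =>
    h (Subtype.ext (sub_right_injective
      ((div_eq_one_iff_eq (sub_ne_zero.2 y.2.2.symm)).1 e)))⟩

/-- The element `(1 - x⁻¹) / (1 - y⁻¹)` of `K \ {0, 1}`. -/
def arg₃ (x y : Gen K) (h : x ≠ y) : Gen K :=
  ⟨(1 - x.1⁻¹) / (1 - y.1⁻¹),
    div_ne_zero (sub_ne_zero.2 fun e => x.2.2 (inv_eq_one.1 e.symm))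
      (sub_ne_zero.2 fun e => y.2.2 (inv_eq_one.1 e.symm)), fun e =>
    h (Subtype.ext (inv_injective (sub_right_injective
      ((div_eq_one_iff_eq
        (sub_ne_zero.2 fun e => y.2.2 (inv_eq_one.1 e.symm))).1 e))))⟩

/-- The Abel five-term element
`[x] - [y] + [y / x] + [(1 - x) / (1 - y)] - [(1 - x⁻¹) / (1 - y⁻¹)]` of `ℤ[K \ {0, 1}]`. -/
def fiveTerm (x y : Gen K) (h : x ≠ y) : FreeAbelianGroup (Gen K) :=
  FreeAbelianGroup.of x - FreeAbelianGroup.of y + FreeAbelianGroup.of (arg₁ x y h)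
    + FreeAbelianGroup.of (arg₂ x y h) - FreeAbelianGroup.of (arg₃ x y h)

/-- The subgroup of `ℤ[K \ {0, 1}]` generated by the Abel five-term elements. -/
def relations (K : Type*) [Field K] : AddSubgroup (FreeAbelianGroup (Gen K)) :=
  AddSubgroup.closure {r | ∃ (x y : Gen K) (h : x ≠ y), r = fiveTerm x y h}

/-- The pre-Bloch group `B₂(K)`. -/
abbrev B₂ (K : Type*) [Field K] : Type _ := FreeAbelianGroup (Gen K) ⧸ relations K

/-- The class `[f]` of `f ∈ K \ {0, 1}` in `B₂(K)`. -/
def cls (f : Gen K) : B₂ K := QuotientAddGroup.mk (FreeAbelianGroup.of f)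

end PreBloch

/-! ### Zeros and degrees of rational functions on an elliptic curve -/

namespace EllDegree

open WeierstrassCurve

variable {k : Type*} [Field k]

/-- The homogeneous coordinates `[X : Y : Z]` of a point of a Weierstrass curve: `[0 : 1 : 0]` for
the point at infinity, `[x : y : 1]` for the affine point `(x, y)`. -/
def coords {W : Affine k} : W.Point → Fin 3 → k
  | .zero => ![0, 1, 0]
  | .some x y _ => ![x, y, 1]

/-- The generic point `[x : y : 1]` of the curve, with the coordinate functions `x` and `y` as
elements of the function field. -/
noncomputable def genericCoords (W : Affine k) : Fin 3 → W.FunctionField :=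
  ![algebraMap W.CoordinateRing W.FunctionField
      (Affine.CoordinateRing.mk W (Polynomial.C Polynomial.X)),
    algebraMap W.CoordinateRing W.FunctionField (Affine.CoordinateRing.mk W Polynomial.X),
    1]

/-- The value in the function field of a homogeneous form in `X, Y, Z` at the generic point. -/
noncomputable def formVal (W : Affine k) : MvPolynomial (Fin 3) k →+* W.FunctionField :=
  MvPolynomial.eval₂Hom (algebraMap k W.FunctionField) (genericCoords W)

/-- The local ring at `P` of the plane projective curve `W`: the rational functions `A / B`, where
`A` and `B` are homogeneous forms of the same degree in `X, Y, Z` and `B` does not vanish at `P`. -/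
def localRing (W : Affine k) (P : W.Point) : Subring W.FunctionField where
  carrier := {f | ∃ (d : ℕ) (A B : MvPolynomial (Fin 3) k),
    A.IsHomogeneous d ∧ B.IsHomogeneous d ∧ MvPolynomial.eval (coords P) B ≠ 0 ∧
      formVal W B ≠ 0 ∧ f = formVal W A / formVal W B}
  one_mem' := ⟨0, 1, 1, MvPolynomial.isHomogeneous_one _ _, MvPolynomial.isHomogeneous_one _ _,
    by simp, by simp, by simp⟩
  zero_mem' := ⟨0, 0, 1, MvPolynomial.isHomogeneous_zero _ _ _,
    MvPolynomial.isHomogeneous_one _ _, by simp, by simp, by simp⟩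
  mul_mem' := by
    rintro f g ⟨d, A, B, hA, hB, hP, h0, rfl⟩ ⟨e, C, D, hC, hD, hQ, h1, rfl⟩
    exact ⟨d + e, A * C, B * D, hA.mul hC, hB.mul hD, by simp [hP, hQ], by simp [h0, h1],
      by simp [div_mul_div_comm]⟩
  add_mem' := by
    rintro f g ⟨d, A, B, hA, hB, hP, h0, rfl⟩ ⟨e, C, D, hC, hD, hQ, h1, rfl⟩
    exact ⟨d + e, A * D + B * C, B * D, (hA.mul hD).add (hB.mul hC), hB.mul hD,
      by simp [hP, hQ], by simp [h0, h1], by simp [div_add_div _ _ h0 h1]⟩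
  neg_mem' := by
    rintro f ⟨d, A, B, hA, hB, hP, h0, rfl⟩
    exact ⟨d, -A, B, hA.neg, hB, hP, h0, by simp [neg_div]⟩

open scoped Classical in
/-- The multiplicity of `P` as a zero of the rational function `f`: the order of vanishing of `f`
in the local ring `𝒪_P` (that is, the length of `𝒪_P / (f)`) if `f` is regular at `P`, and `0` if
`f` has a pole at `P`. -/
noncomputable def zeroMult (W : Affine k) (f : W.FunctionField) (P : W.Point) : ℕ∞ :=
  if h : f ∈ localRing W P then Ring.ord (localRing W P) ⟨f, h⟩ else 0

/-- The degree of a non-zero rational function `f`: the number of its zeros, counted with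
multiplicities (the sum over all points, written as the supremum of the finite partial sums). -/
noncomputable def degree (W : Affine k) (f : W.FunctionField) : ℕ∞ :=
  ⨆ s : Finset W.Point, ∑ P ∈ s, zeroMult W f P

end EllDegree

/-! ### Integral divisors -/

namespace Finsupp

variable {σ : Type*}

/-! The proof is a descent on the degree by means of the five-term relation. Let f have degree at
least 4. Choose effective divisors a, b, c of degree 2 contained in the zeros of f, the poles of f
and the zeros of 1 - f; they have disjoint supports. Suppose that g has degree at most 3, vanishes
on a, has poles on b and takes the value 1 on c. In each of g/f, (1 - f)/(1 - g) and (1 - f⁻¹)/(1 -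
g⁻¹) two of these pairs cancel, so the degree is at most deg f + deg g - 4 < deg f. The five-term
relation then expresses [f] by classes of smaller degree (`cls_mem_of_common`).

To find g, take functions x, y, v with polar divisors a, b, c. The seven functions xy, xv, yv, x, y,
v, 1 lie in L(a + b + c), of dimension at most 6, hence satisfy a linear relation
(`exists_quadric`). If the coefficients of xy, xv, yv are all nonzero, an affine change of x, y, v
brings the relation to the form xy + yv + vx = -τ² (`exists_affine_of_relation`). Then g = (v +
τ)/(x + v) = (y + v)/(v - τ) and 1 - g = (x - τ)/(x + v) take the required values. A common zero of
v + τ and x - τ cancels in g and lowers its degree from 4 to 3; if there is none, then b and c are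
linearly equivalent (`exists_of_quadric`). If one of the three coefficients is zero, two of the
pairs are again linearly equivalent (`linEquiv_of_relation`). In these degenerate cases a function
of degree 2 matches two of the pairs and one point of the third, which still suffices
(`cls_mem_of_linEquiv`).

The argument uses only a family of valuations with the product formula (`OrderSystem`) and two facts
on genus one (`IsGenusOne`): no function has a single simple pole, and L(P + Q) contains a
nonconstant function. For a Weierstrass curve the valuations come from explicit uniformizers, the
product formula from the norm to k[x] and the involution P ↦ -P, and the two facts from the
description of L(nO) by polynomials in x and y (`isGenusOne`). -/

lemma degree_nonneg_of_nonneg {D : σ →₀ ℤ} (h : ∀ P, 0 ≤ D P) : 0 ≤ D.degree :=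
  Finset.sum_nonneg fun P _ => h P

lemma degree_le_degree {D D' : σ →₀ ℤ} (h : ∀ P, D P ≤ D' P) : D.degree ≤ D'.degree := by
  have := degree_nonneg_of_nonneg (D := D' - D) fun P => by simpa using h P
  rw [map_sub] at this
  linarith

lemma eq_of_le_of_degree_le {D D' : σ →₀ ℤ} (h : ∀ P, D P ≤ D' P)
    (hd : D'.degree ≤ D.degree) : D = D' := by
  have h0 : (D' - D).degree = 0 := by
    have := degree_le_degree h
    rw [map_sub]
    linarith
  have h1 := (Finset.sum_eq_zero_iff_of_nonneg
    (fun P _ => by simpa using h P : ∀ P ∈ (D' - D).support, 0 ≤ (D' - D) P)).1 h0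
  ext P
  by_cases hP : P ∈ (D' - D).support
  · have := h1 P hP
    simp only [coe_sub, Pi.sub_apply] at this
    linarith
  · have := notMem_support_iff.1 hP
    simp only [coe_sub, Pi.sub_apply] at this
    linarith

lemma exists_pos_of_degree_pos {D : σ →₀ ℤ} (h : 0 < D.degree) : ∃ P, 0 < D P := by
  by_contra! h'
  have := degree_le_degree (D := D) (D' := 0) (by simpa using h')
  simp only [map_zero] at this
  linarith

lemma single_one_apply_nonneg (P Q : σ) : (0 : ℤ) ≤ single P 1 Q := by
  classical
  rw [single_apply]
  split_ifs <;> norm_num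

lemma single_one_le {D : σ →₀ ℤ} (hD : ∀ P, 0 ≤ D P) {P : σ} (hP : 0 < D P) (Q : σ) :
    single P 1 Q ≤ D Q := by
  classical
  rw [single_apply]
  split_ifs with h
  · exact h ▸ hP
  · exact hD Q

lemma exists_single_add_single_le {D : σ →₀ ℤ} (hD : ∀ P, 0 ≤ D P) (h : 2 ≤ D.degree) :
    ∃ P Q : σ, ∀ R, (single P 1 + single Q 1 : σ →₀ ℤ) R ≤ D R := by
  obtain ⟨P, hP⟩ := exists_pos_of_degree_pos (D := D) (by linarith)
  have h1 : ∀ R, 0 ≤ (D - single P 1 : σ →₀ ℤ) R := fun R => by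
    simpa only [coe_sub, Pi.sub_apply, sub_nonneg] using single_one_le hD hP R
  obtain ⟨Q, hQ⟩ := exists_pos_of_degree_pos (D := D - single P 1) (by
    rw [map_sub, degree_single]; linarith)
  refine ⟨P, Q, fun R => ?_⟩
  have := single_one_le h1 hQ R
  simp only [coe_add, Pi.add_apply, coe_sub, Pi.sub_apply] at *
  linarith

end Finsupp

/-! ### Fields of functions with orders of vanishing -/

/-- A family of discrete valuations `ord P` (with `ord P 0 = 0`) on a field `K` of functions over
`k`, indexed by a set of points with residue field `k`, and satisfying the product formula. -/
structure OrderSystem (k K Pt : Type*) [Field k] [Field K] [Algebra k K] where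
  ord : Pt → K → ℤ
  ord_mul : ∀ (P : Pt) {f g : K}, f ≠ 0 → g ≠ 0 → ord P (f * g) = ord P f + ord P g
  min_le_ord_add : ∀ (P : Pt) {f g : K}, f ≠ 0 → g ≠ 0 → f + g ≠ 0 →
    min (ord P f) (ord P g) ≤ ord P (f + g)
  ord_algebraMap : ∀ (P : Pt) (c : k), ord P (algebraMap k K c) = 0
  finite_support : ∀ f : K, (Function.support fun P => ord P f).Finite
  degree_eq_zero : ∀ f : K, (Finsupp.ofSupportFinite _ (finite_support f)).degree = 0
  exists_residue : ∀ (P : Pt) {f : K}, f ≠ 0 → ord P f = 0 →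
    ∃ c : k, f ≠ algebraMap k K c → 0 < ord P (f - algebraMap k K c)

namespace OrderSystem

open Finsupp Module

variable {k K Pt : Type*} [Field k] [Field K] [Algebra k K] (O : OrderSystem k K Pt)

lemma ord_zero (P : Pt) : O.ord P 0 = 0 := by
  simpa using O.ord_algebraMap P 0

lemma ord_one (P : Pt) : O.ord P 1 = 0 := by
  simpa using O.ord_algebraMap P 1

lemma ord_neg (P : Pt) (f : K) : O.ord P (-f) = O.ord P f := by
  by_cases hf : f = 0
  · simp [hf]
  · have := O.ord_mul P (f := algebraMap k K (-1)) (g := f) (by simp) hf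
    rw [O.ord_algebraMap] at this
    simpa using this

lemma ord_inv (P : Pt) (f : K) : O.ord P f⁻¹ = -O.ord P f := by
  by_cases hf : f = 0
  · simp [hf, O.ord_zero]
  · have := O.ord_mul P hf (inv_ne_zero hf)
    rw [mul_inv_cancel₀ hf, O.ord_one] at this
    linarith

lemma ord_div (P : Pt) {f g : K} (hf : f ≠ 0) (hg : g ≠ 0) :
    O.ord P (f / g) = O.ord P f - O.ord P g := by
  rw [div_eq_mul_inv, O.ord_mul P hf (inv_ne_zero hg), O.ord_inv, sub_eq_add_neg]

lemma ord_sub_comm (P : Pt) (f g : K) : O.ord P (f - g) = O.ord P (g - f) := by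
  rw [← O.ord_neg, neg_sub]

lemma ord_const_mul (P : Pt) {c : k} (hc : c ≠ 0) (f : K) :
    O.ord P (algebraMap k K c * f) = O.ord P f := by
  by_cases hf : f = 0
  · simp [hf]
  · rw [O.ord_mul P (by simpa using hc) hf, O.ord_algebraMap, zero_add]

/-- `f` vanishes to order at least `n` at `P`. -/
def Vanishes (P : Pt) (n : ℤ) (f : K) : Prop := f ≠ 0 → n ≤ O.ord P f

variable {O}

lemma Vanishes.mono {P : Pt} {m n : ℤ} {f : K} (h : O.Vanishes P n f) (hmn : m ≤ n) :
    O.Vanishes P m f := fun hf => hmn.trans (h hf)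

lemma Vanishes.add {P : Pt} {n : ℤ} {f g : K} (hf : O.Vanishes P n f) (hg : O.Vanishes P n g) :
    O.Vanishes P n (f + g) := fun h => by
  by_cases hf0 : f = 0
  · subst hf0
    rw [zero_add] at h ⊢
    exact hg h
  by_cases hg0 : g = 0
  · subst hg0
    rw [add_zero] at h ⊢
    exact hf h
  exact (le_min (hf hf0) (hg hg0)).trans (O.min_le_ord_add P hf0 hg0 h)

lemma Vanishes.neg {P : Pt} {n : ℤ} {f : K} (hf : O.Vanishes P n f) : O.Vanishes P n (-f) :=
  fun h => by
    rw [O.ord_neg]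
    exact hf (neg_ne_zero.1 h)

lemma Vanishes.sub {P : Pt} {n : ℤ} {f g : K} (hf : O.Vanishes P n f) (hg : O.Vanishes P n g) :
    O.Vanishes P n (f - g) := by
  rw [sub_eq_add_neg]
  exact hf.add hg.neg

lemma Vanishes.mul {P : Pt} {m n : ℤ} {f g : K} (hf : O.Vanishes P m f) (hg : O.Vanishes P n g) :
    O.Vanishes P (m + n) (f * g) := fun h => by
  have hf0 := left_ne_zero_of_mul h
  have hg0 := right_ne_zero_of_mul h
  rw [O.ord_mul P hf0 hg0]
  exact add_le_add (hf hf0) (hg hg0)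

variable (O)

lemma vanishes_const (P : Pt) (c : k) : O.Vanishes P 0 (algebraMap k K c) := fun _ =>
  (O.ord_algebraMap P c).ge

lemma vanishes_ord (P : Pt) (f : K) : O.Vanishes P (O.ord P f) f := fun _ => le_rfl

variable {O}

lemma Vanishes.const_mul {P : Pt} {n : ℤ} {f : K} (c : k) (hf : O.Vanishes P n f) :
    O.Vanishes P n (algebraMap k K c * f) := by
  simpa using (O.vanishes_const P c).mul hf

/-- The ultrametric inequality is an equality when the two orders differ: if the sum vanished to
higher order, then so would f, being the sum minus g. -/
lemma ord_add_eq {P : Pt} {f g : K} (hf : f ≠ 0) (hg : O.Vanishes P (O.ord P f + 1) g) :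
    f + g ≠ 0 ∧ O.ord P (f + g) = O.ord P f := by
  have h0 : f + g ≠ 0 := fun h => by
    have hgf : g = -f := (neg_eq_of_add_eq_zero_right h).symm
    rw [hgf] at hg
    have := hg (neg_ne_zero.2 hf)
    rw [O.ord_neg] at this
    linarith
  refine ⟨h0, le_antisymm ?_ ((O.vanishes_ord P f).add (hg.mono (by linarith)) h0)⟩
  by_contra! hlt
  have h1 : O.Vanishes P (O.ord P f + 1) (f + g) := fun _ => hlt
  have h2 := h1.sub hg
  rw [add_sub_cancel_right] at h2
  have := h2 hf
  linarith

variable (O)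

/-- The divisor of `f`. -/
noncomputable def divisor (f : K) : Pt →₀ ℤ := ofSupportFinite _ (O.finite_support f)

@[simp] lemma divisor_apply (f : K) (P : Pt) : O.divisor f P = O.ord P f := rfl

lemma degree_divisor (f : K) : (O.divisor f).degree = 0 := O.degree_eq_zero f

/-- The divisor of zeros of `f`. -/
noncomputable def zeros (f : K) : Pt →₀ ℤ := (O.divisor f).mapRange (max · 0) (by simp)

/-- The divisor of poles of `f`. -/
noncomputable def poles (f : K) : Pt →₀ ℤ := (O.divisor f).mapRange (max (-·) 0) (by simp)

@[simp] lemma zeros_apply (f : K) (P : Pt) : O.zeros f P = max (O.ord P f) 0 := by simp [zeros]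

@[simp] lemma poles_apply (f : K) (P : Pt) : O.poles f P = max (-O.ord P f) 0 := by simp [poles]

lemma degree_poles (f : K) : (O.poles f).degree = (O.zeros f).degree := by
  have h : O.zeros f - O.poles f = O.divisor f := by
    ext P
    simp only [Finsupp.coe_sub, Pi.sub_apply, zeros_apply, poles_apply, divisor_apply]
    omega
  have := congrArg Finsupp.degree h
  rw [map_sub, O.degree_divisor] at this
  linarith

variable {O}

/-- The difference div f - D is effective of degree at most 0, hence zero. This turns one-sided
estimates of orders into linear equivalences. -/
lemma divisor_eq_of_le {f : K} {D : Pt →₀ ℤ} (hD : 0 ≤ D.degree) (h : ∀ P, D P ≤ O.ord P f) :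
    ∀ P, O.ord P f = D P := fun P => by
  have := eq_of_le_of_degree_le (D := D) (D' := O.divisor f) (by simpa using h)
    (by rw [O.degree_divisor]; exact hD)
  rw [this, divisor_apply]

variable (O)

/-- The space `L(D)` of functions with `div f + D ≥ 0`. -/
def space (D : Pt →₀ ℤ) : Submodule k K where
  carrier := {f | ∀ P, O.Vanishes P (-D P) f}
  zero_mem' := fun _ h => absurd rfl h
  add_mem' := fun hf hg P => (hf P).add (hg P)
  smul_mem' := fun c f hf P => by
    rw [Algebra.smul_def]
    exact (hf P).const_mul c

lemma space_mono {D D' : Pt →₀ ℤ} (h : ∀ P, D P ≤ D' P) : O.space D ≤ O.space D' :=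
  fun _ hf P => (hf P).mono (neg_le_neg (h P))

lemma exists_const_mul_sub {P : Pt} {f g : K} (hf : f ≠ 0) (hg : g ≠ 0)
    (h : O.ord P f = O.ord P g) :
    ∃ c : k, O.Vanishes P (O.ord P g + 1) (f - algebraMap k K c * g) := by
  obtain ⟨c, hc⟩ := O.exists_residue P (f := f / g) (div_ne_zero hf hg)
    (by rw [O.ord_div P hf hg, h, sub_self])
  refine ⟨c, ?_⟩
  have h1 : O.Vanishes P 1 (f / g - algebraMap k K c) := fun h0 => hc (sub_ne_zero.1 h0)
  have h2 := h1.mul (O.vanishes_ord P g)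
  rwa [sub_mul, div_mul_cancel₀ _ hg, add_comm] at h2

/-- Only the condition at P separates the two spaces. An element g that fails it has order exactly
-D(P) - 1 there, and since the residue field is k, any other such element becomes a member of L(D)
after subtraction of a constant multiple of g. -/
lemma space_add_single_le (D : Pt →₀ ℤ) (P : Pt) :
    ∃ g : K, O.space (D + single P 1) ≤ O.space D ⊔ k ∙ g := by
  classical
  by_cases h : O.space (D + single P 1) ≤ O.space D
  · exact ⟨0, h.trans le_sup_left⟩
  obtain ⟨g, hg, hgD⟩ := Set.not_subset.1 h
  have key : ∀ f ∈ O.space (D + single P 1), O.Vanishes P (-D P) f → f ∈ O.space D := by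
    intro f hf hfP Q
    by_cases hQ : Q = P
    · exact hQ ▸ hfP
    · have := hf Q
      rwa [Finsupp.add_apply, single_eq_of_ne hQ, add_zero] at this
  have hgP : ¬ O.Vanishes P (-D P) g := fun h' => hgD (key g hg h')
  have ordg : ∀ f ∈ O.space (D + single P 1), ¬ O.Vanishes P (-D P) f →
      f ≠ 0 ∧ O.ord P f = -D P - 1 := by
    intro f hf hfP
    rw [Vanishes, Classical.not_imp, not_le] at hfP
    have := hf P hfP.1
    rw [Finsupp.add_apply, single_eq_same] at this
    exact ⟨hfP.1, by omega⟩
  obtain ⟨hg0, hg1⟩ := ordg g hg hgP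
  refine ⟨g, fun f hf => ?_⟩
  by_cases hfP : O.Vanishes P (-D P) f
  · exact Submodule.mem_sup_left (key f hf hfP)
  obtain ⟨hf0, hf1⟩ := ordg f hf hfP
  obtain ⟨c, hc⟩ := O.exists_const_mul_sub hf0 hg0 (hf1.trans hg1.symm)
  rw [← Algebra.smul_def] at hc
  have h1 : f - c • g ∈ O.space D := by
    refine key _ (sub_mem hf (Submodule.smul_mem _ c hg)) (hc.mono ?_)
    omega
  exact Submodule.mem_sup.2 ⟨_, h1, c • g, Submodule.smul_mem _ c (Submodule.mem_span_singleton_self g),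
    sub_add_cancel _ _⟩

lemma finrank_span_singleton_le (g : K) : finrank k (k ∙ g) ≤ 1 :=
  (finrank_span_le_card {g}).trans (by simp)

lemma finrank_space_add_single_le (D : Pt →₀ ℤ) (P : Pt) [Module.Finite k (O.space D)] :
    Module.Finite k (O.space (D + single P 1)) ∧
      finrank k (O.space (D + single P 1)) ≤ finrank k (O.space D) + 1 := by
  obtain ⟨g, hg⟩ := O.space_add_single_le D P
  have h1 := finrank_span_singleton_le (k := k) g
  refine ⟨Submodule.finiteDimensional_of_le hg, (Submodule.finrank_mono hg).trans
    ((Submodule.finrank_add_le_finrank_add_finrank _ _).trans (by gcongr))⟩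

end OrderSystem

/-! ### Genus one: functions with two poles, linear equivalence -/

namespace OrderSystem

open Finsupp Module

variable {k K Pt : Type*} [Field k] [Field K] [Algebra k K] (O : OrderSystem k K Pt)

/-- The properties of the valuations of the function field of a curve of genus one that say that
there is no function with a single simple pole, and that any two points are the poles of a
function. -/
structure IsGenusOne : Prop where
  mem_range_of_simple_pole : ∀ (P : Pt) (f : K), f ∈ O.space (single P 1) →
    f ∈ (algebraMap k K).range
  exists_mem_space_single_add_single : ∀ P Q : Pt,
    ∃ f ∈ O.space (single P 1 + single Q 1), f ∉ (algebraMap k K).range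

/-- The divisors `a` and `b` are linearly equivalent. -/
def LinEquiv (a b : Pt →₀ ℤ) : Prop := ∃ u : K, u ≠ 0 ∧ ∀ P, O.ord P u = a P - b P

variable {O}

lemma LinEquiv.symm {a b : Pt →₀ ℤ} (h : O.LinEquiv a b) : O.LinEquiv b a := by
  obtain ⟨u, hu, h⟩ := h
  exact ⟨u⁻¹, inv_ne_zero hu, fun P => by rw [O.ord_inv, h P]; ring⟩

lemma IsGenusOne.exists_poles_eq (hO : O.IsGenusOne) {a : Pt →₀ ℤ}
    (ha : ∃ P Q : Pt, a = single P 1 + single Q 1) : ∃ f : K, O.poles f = a := by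
  obtain ⟨P, Q, rfl⟩ := ha
  obtain ⟨f, hf, hf'⟩ := hO.exists_mem_space_single_add_single P Q
  have hf0 : f ≠ 0 := fun h => hf' ⟨0, by simp [h]⟩
  refine ⟨f, ?_⟩
  have hle : ∀ R, O.poles f R ≤ (single P 1 + single Q 1 : Pt →₀ ℤ) R := fun R => by
    have h1 := hf R hf0
    have h2 := single_one_apply_nonneg P R
    have h3 := single_one_apply_nonneg Q R
    simp only [poles_apply, Finsupp.add_apply] at *
    omega
  ext R
  refine le_antisymm (hle R) ?_
  -- If the polar divisor is missing the point R, at most one simple pole is left and f is constant.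
  by_contra! hlt
  suffices h : ∃ S, f ∈ O.space (single S 1) by
    obtain ⟨S, hS⟩ := h
    exact hf' (hO.mem_range_of_simple_pole S f hS)
  classical
  have key : ∀ T, -(single P 1 + single Q 1 - single R 1 : Pt →₀ ℤ) T ≤ O.ord T f := fun T => by
    have := hle T
    by_cases hT : T = R
    · subst hT
      simp only [poles_apply, Finsupp.add_apply, Finsupp.sub_apply, single_eq_same] at *
      omega
    · simp only [poles_apply, Finsupp.add_apply, Finsupp.sub_apply, single_eq_of_ne hT] at *
      omega
  by_cases hRP : R = P
  · refine ⟨Q, fun T _ => ?_⟩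
    have := key T
    rwa [hRP, add_sub_cancel_left] at this
  · have hRQ : R = Q := by
      by_contra hRQ
      rw [Finsupp.add_apply, single_eq_of_ne hRP, single_eq_of_ne hRQ, poles_apply] at hlt
      omega
    refine ⟨P, fun T _ => ?_⟩
    have := key T
    rwa [hRQ, add_sub_cancel_right] at this

/-- The easy half of Riemann–Roch: L(P) consists of constants, and each further point adds at most
one dimension. -/
lemma IsGenusOne.finrank_space_le (hO : O.IsGenusOne) (s : Multiset Pt) (P : Pt) {D : Pt →₀ ℤ}
    (hD : D = single P 1 + (s.map fun Q => single Q (1 : ℤ)).sum) :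
    Module.Finite k (O.space D) ∧ finrank k (O.space D) ≤ s.card + 1 := by
  induction s using Multiset.induction_on generalizing D with
  | empty =>
    obtain rfl : D = single P 1 := by simpa using hD
    have h : O.space (single P 1) ≤ k ∙ (1 : K) := fun f hf => by
      obtain ⟨c, rfl⟩ := hO.mem_range_of_simple_pole P f hf
      exact Submodule.mem_span_singleton.2 ⟨c, by simp [Algebra.smul_def]⟩
    exact ⟨Submodule.finiteDimensional_of_le h,
      (Submodule.finrank_mono h).trans (finrank_span_singleton_le 1)⟩
  | cons Q s ih =>
    obtain ⟨h1, h2⟩ := ih rfl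
    obtain rfl : D = single P 1 + (s.map fun Q => single Q (1 : ℤ)).sum + single Q 1 := by
      rw [hD, Multiset.map_cons, Multiset.sum_cons]
      abel
    have := O.finrank_space_add_single_le
      (single P 1 + (s.map fun Q => single Q (1 : ℤ)).sum) Q
    rw [Multiset.card_cons]
    exact ⟨this.1, this.2.trans (by omega)⟩

variable (O)

lemma poles_const (c : k) : O.poles (algebraMap k K c) = 0 := by
  ext P
  simp [O.ord_algebraMap]

lemma poles_affine {c : k} (hc : c ≠ 0) (d : k) (f : K) :
    O.poles (algebraMap k K c * f + algebraMap k K d) = O.poles f := by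
  by_cases hf : f = 0
  · rw [hf, mul_zero, zero_add, O.poles_const, ← map_zero (algebraMap k K), O.poles_const]
  have hcf : algebraMap k K c * f ≠ 0 := mul_ne_zero (by simpa using hc) hf
  ext P
  simp only [poles_apply]
  rcases lt_or_ge (O.ord P f) 0 with h | h
  · rw [(ord_add_eq hcf ((O.vanishes_const P d).mono ?_)).2, O.ord_const_mul P hc]
    rw [O.ord_const_mul P hc]
    omega
  · have h1 : O.Vanishes P 0 (algebraMap k K c * f + algebraMap k K d) :=
      (Vanishes.const_mul c fun _ => h).add (O.vanishes_const P d)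
    by_cases h0 : algebraMap k K c * f + algebraMap k K d = 0
    · rw [h0, O.ord_zero]
      omega
    · have := h1 h0
      omega

variable {O}

lemma vanishes_of_poles_eq {f : K} {a : Pt →₀ ℤ} (hf : O.poles f = a) (P : Pt) :
    O.Vanishes P (-a P) f := fun _ => by
  rw [← hf, poles_apply]
  omega

lemma ord_eq_of_poles_eq {f : K} {a : Pt →₀ ℤ} (hf : O.poles f = a) {P : Pt} (hP : 0 < a P) :
    O.ord P f = -a P := by
  rw [← hf, poles_apply] at *
  omega

lemma poles_nonneg (f : K) (P : Pt) : 0 ≤ O.poles f P := by simp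

lemma ne_const_of_poles_eq {f : K} {a : Pt →₀ ℤ} (hf : O.poles f = a) (ha : 0 < a.degree)
    (c : k) : f ≠ algebraMap k K c := by
  rintro rfl
  rw [← hf, O.poles_const] at ha
  simp at ha

lemma poles_add_const {f : K} {a : Pt →₀ ℤ} (hf : O.poles f = a) (c : k) :
    O.poles (f + algebraMap k K c) = a := by
  have := O.poles_affine one_ne_zero c f
  rwa [map_one, one_mul, hf] at this

lemma poles_sub_const {f : K} {a : Pt →₀ ℤ} (hf : O.poles f = a) (c : k) :
    O.poles (f - algebraMap k K c) = a := by
  rw [sub_eq_add_neg, ← map_neg]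
  exact poles_add_const hf _

/-- Effective divisors with disjoint supports. -/
def Disj (a b : Pt →₀ ℤ) : Prop := ∀ P, a P = 0 ∨ b P = 0

lemma Disj.symm {a b : Pt →₀ ℤ} (h : Disj a b) : Disj b a := fun P => (h P).symm

/-- A relation between `xy`, `xv`, `x`, `y`, `v`, `1` without `yv` forces the poles of `x` and `y`
to be linearly equivalent. -/
lemma linEquiv_of_relation {x y v : K} {a b c : Pt →₀ ℤ} (hx : O.poles x = a) (hy : O.poles y = b)
    (hv : O.poles v = c) (ha : 0 < a.degree) (hab : a.degree = b.degree)
    (dab : Disj a b) (dbc : Disj b c) {p q l m n t : k} (hp : p ≠ 0)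
    (h : algebraMap k K p * (x * y) + algebraMap k K q * (x * v) + algebraMap k K l * x +
      algebraMap k K m * y + algebraMap k K n * v + algebraMap k K t = 0) :
    O.LinEquiv b a := by
  -- The shift by m/p absorbs the y-term: x'(py + qv + l) is then an affine function of v. At a
  -- point of b the latter is regular while py + qv + l has a pole of order b(P), so x' vanishes
  -- there to order b(P).
  set x' := x + algebraMap k K (m / p) with hx'
  have hpx : O.poles x' = a := poles_add_const hx _
  have hx0 : x' ≠ 0 := by simpa using ne_const_of_poles_eq hpx ha 0
  refine ⟨x', hx0, ?_⟩
  suffices hle : ∀ P, (b - a) P ≤ O.ord P x' from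
    divisor_eq_of_le (by rw [map_sub, hab, sub_self]) hle
  intro P
  rw [Finsupp.sub_apply]
  have hbP : 0 ≤ b P := by rw [← hy]; exact poles_nonneg y P
  rcases hbP.eq_or_lt with hb | hb
  · have := vanishes_of_poles_eq hpx P hx0
    omega
  have haP : a P = 0 := (dab P).resolve_right hb.ne'
  have hcP : c P = 0 := (dbc P).resolve_left hb.ne'
  have hp' : algebraMap k K p ≠ 0 := by simpa using hp
  have hy0 : y ≠ 0 := by
    simpa using ne_const_of_poles_eq hy (hab ▸ ha) 0
  have hvP : O.Vanishes P 0 v := by simpa [hcP] using vanishes_of_poles_eq hv P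
  have h1 : O.Vanishes P 0 (algebraMap k K q * v + algebraMap k K l) :=
    (hvP.const_mul q).add (O.vanishes_const P l)
  have h2 := ord_eq_of_poles_eq hy hb
  have h3 := ord_add_eq (O := O) (P := P) (mul_ne_zero hp' hy0) (h1.mono (by
    rw [O.ord_const_mul P hp, h2]; omega))
  rw [O.ord_const_mul P hp, h2] at h3
  have h4 : x' * (algebraMap k K p * y + (algebraMap k K q * v + algebraMap k K l)) =
      -(algebraMap k K (n - m * q / p) * v + algebraMap k K (t - m * l / p)) := by
    rw [hx']
    simp only [map_sub, map_div₀, map_mul]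
    field_simp
    linear_combination algebraMap k K p * h
  have h5 : O.Vanishes P 0 (x' * (algebraMap k K p * y + (algebraMap k K q * v +
      algebraMap k K l))) := by
    rw [h4]
    exact ((hvP.const_mul _).add (O.vanishes_const P _)).neg
  have h6 := h5 (mul_ne_zero hx0 h3.1)
  rw [O.ord_mul P hx0 h3.1, h3.2] at h6
  omega

end OrderSystem

/-! ### The interpolating function of degree at most three -/

namespace OrderSystem

open Finsupp Module

variable {k K Pt : Type*} [Field k] [Field K] [Algebra k K] {O : OrderSystem k K Pt}

lemma poles_one_sub (f : K) : O.poles (1 - f) = O.poles f := by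
  have := O.poles_affine (neg_ne_zero.2 one_ne_zero) 1 f
  rw [← this]
  congr 1
  simp
  ring

lemma degree_zeros_one_sub (f : K) : (O.zeros (1 - f)).degree = (O.zeros f).degree := by
  rw [← O.degree_poles, poles_one_sub, O.degree_poles]

/-- If `xy + yv + vx = -τ²`, where `x`, `y` and `v` have pairs of poles `a`, `b` and `c`, then
`(v + τ) / (x + v)` is a function of degree at most `3` that vanishes on `a`, has poles on `b` and
takes the value `1` on `c`, unless `c` and `b` are linearly equivalent. -/
lemma exists_of_quadric {x y v : K} {a b c : Pt →₀ ℤ} (hx : O.poles x = a) (hy : O.poles y = b)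
    (hv : O.poles v = c) (ha : a.degree = 2) (hb : b.degree = 2) (hc : c.degree = 2)
    (dab : Disj a b) (dac : Disj a c) (dbc : Disj b c) {τ : k}
    (h : x * y + y * v + v * x = -(algebraMap k K τ) ^ 2) :
    O.LinEquiv c b ∨ ∃ g : K, g ≠ 0 ∧ g ≠ 1 ∧ (∀ P, a P ≤ O.zeros g P) ∧
      (∀ P, b P ≤ O.poles g P) ∧ (∀ P, c P ≤ O.zeros (1 - g) P) ∧ (O.zeros g).degree ≤ 3 := by
  set T := algebraMap k K τ with hT
  have hxp : O.poles (x + T) = a := poles_add_const hx τ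
  have hxm : O.poles (x - T) = a := poles_sub_const hx τ
  have hyp : O.poles (y + T) = b := poles_add_const hy τ
  have hym : O.poles (y - T) = b := poles_sub_const hy τ
  have hvp : O.poles (v + T) = c := poles_add_const hv τ
  have hvm : O.poles (v - T) = c := poles_sub_const hv τ
  have ne0 : ∀ {f : K} {d : Pt →₀ ℤ}, O.poles f = d → d.degree = 2 → f ≠ 0 := fun hf hd => by
    simpa using ne_const_of_poles_eq hf (by rw [hd]; norm_num) 0
  have hx0 := ne0 hx ha
  have hxp0 := ne0 hxp ha
  have hxm0 := ne0 hxm ha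
  have hy0 := ne0 hy hb
  have hym0 := ne0 hym hb
  have hvp0 := ne0 hvp hc
  have hvm0 := ne0 hvm hc
  have a0 : ∀ P, 0 ≤ a P := fun P => hx ▸ poles_nonneg x P
  have b0 : ∀ P, 0 ≤ b P := fun P => hy ▸ poles_nonneg y P
  have c0 : ∀ P, 0 ≤ c P := fun P => hv ▸ poles_nonneg v P
  -- the sum of two functions has the poles of both
  have add_poles : ∀ {f g : K} {d e : Pt →₀ ℤ}, O.poles f = d → O.poles g = e → d.degree = 2 →
      Disj d e → ∀ P, 0 < d P → f + g ≠ 0 ∧ O.ord P (f + g) = -d P := by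
    intro f g d e hf hg hd hde P hP
    have h1 := ord_eq_of_poles_eq hf hP
    rw [← h1]
    refine ord_add_eq (ne0 hf hd) ((vanishes_of_poles_eq hg P).mono ?_)
    have := (hde P).resolve_left hP.ne'
    omega
  obtain ⟨P₀, hP₀⟩ := exists_pos_of_degree_pos (D := a) (by rw [ha]; norm_num)
  have hxv0 : x + v ≠ 0 := (add_poles hx hv ha dac P₀ hP₀).1
  -- The two factorisations of the quadratic relation: the first gives the second expression for g,
  -- the second relates the zeros of v + τ to those of y - τ.
  have hid1 : (x + v) * (y + v) = (v - T) * (v + T) := by linear_combination h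
  have hyv0 : y + v ≠ 0 := right_ne_zero_of_mul (hid1 ▸ mul_ne_zero hvm0 hvp0)
  have hid2 : (y - T) * (x + v) = -((v + T) * (x + T)) := by linear_combination h
  have hxvP : ∀ P, 0 < a P → O.ord P (x + v) = -a P := fun P hP =>
    (add_poles hx hv ha dac P hP).2
  have hxvP' : ∀ P, 0 < c P → O.ord P (x + v) = -c P := fun P hP => by
    rw [add_comm x v]
    exact (add_poles hv hx hc dac.symm P hP).2
  have hyvP : ∀ P, 0 < b P → O.ord P (y + v) = -b P := fun P hP =>
    (add_poles hy hv hb dbc P hP).2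
  set g := (v + T) / (x + v) with hg
  have hg0 : g ≠ 0 := div_ne_zero hvp0 hxv0
  have h1g : 1 - g = (x - T) / (x + v) := by
    rw [hg]
    field_simp
    ring
  have h1g0 : 1 - g ≠ 0 := h1g ▸ div_ne_zero hxm0 hxv0
  have hg' : g = (y + v) / (v - T) := by
    rw [hg, div_eq_div_iff hxv0 hvm0]
    linear_combination -hid1
  have ordg : ∀ P, O.ord P g = O.ord P (v + T) - O.ord P (x + v) := fun P =>
    O.ord_div P hvp0 hxv0
  -- A common zero of v + τ and x - τ is also a zero of their sum x + v, so it cancels in g = (v +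
  -- τ)/(x + v).
  by_cases hcommon : ∃ P, 0 < O.ord P (v + T) ∧ 0 < O.ord P (x - T)
  · right
    refine ⟨g, hg0, fun h => h1g0 (by rw [h, sub_self]), fun P => ?_, fun P => ?_, fun P => ?_, ?_⟩
    · rcases (a0 P).eq_or_lt with hP | hP
      · simp [← hP]
      have h1 := vanishes_of_poles_eq hvp P hvp0
      have h2 := (dac P).resolve_left hP.ne'
      have h3 := hxvP P hP
      rw [zeros_apply, ordg]
      omega
    · rcases (b0 P).eq_or_lt with hP | hP
      · simp [← hP]
      have h1 := vanishes_of_poles_eq hvm P hvm0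
      have h2 := (dbc P).resolve_left hP.ne'
      have h3 := hyvP P hP
      rw [poles_apply, hg', O.ord_div P hyv0 hvm0]
      omega
    · rcases (c0 P).eq_or_lt with hP | hP
      · simp [← hP]
      have h1 := vanishes_of_poles_eq hxm P hxm0
      have h2 := (dac P).resolve_right hP.ne'
      have h3 := hxvP' P hP
      rw [zeros_apply, h1g, O.ord_div P hxm0 hxv0]
      omega
    · obtain ⟨Q, hQ1, hQ2⟩ := hcommon
      -- The zeros of g are bounded by those of v + τ together with a, in total degree 4; the common
      -- zero Q takes away one.
      have hdeg : (O.zeros (v + T) + a - single Q 1).degree = 3 := by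
        rw [map_sub, map_add, degree_single, ← O.degree_poles, hvp, ha, hc]
        norm_num
      rw [← hdeg]
      refine degree_le_degree fun P => ?_
      have hc1 : O.poles (v + T) P = c P := by rw [hvp]
      have ha1 : O.poles (x - T) P = a P := by rw [hxm]
      have hgen : c P = 0 → -a P ≤ O.ord P (x + v) := fun hcP =>
        ((vanishes_of_poles_eq hx P).add ((vanishes_of_poles_eq hv P).mono (by
          have := a0 P; omega))) hxv0
      have hpos : c P = 0 ∨ O.ord P (x + v) = -c P := by
        rcases (c0 P).eq_or_lt with hP | hP
        · exact Or.inl hP.symm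
        · exact Or.inr (hxvP' P hP)
      have haP := a0 P
      have hcP := c0 P
      by_cases hPQ : P = Q
      · subst hPQ
        have h1 : O.Vanishes P 1 (v + T) := fun _ => hQ1
        have h2 : O.Vanishes P 1 (x - T) := fun _ => hQ2
        have h3 := h1.add h2
        rw [show v + T + (x - T) = x + v by ring] at h3
        have h4 := h3 hxv0
        rw [zeros_apply, ordg, Finsupp.sub_apply, Finsupp.add_apply, zeros_apply, single_eq_same]
        omega
      · rw [zeros_apply, ordg, Finsupp.sub_apply, Finsupp.add_apply, zeros_apply,
          single_eq_of_ne hPQ]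
        rw [poles_apply] at hc1
        omega
  · left
    push Not at hcommon
    refine ⟨(y - T) / (v + T), div_ne_zero hym0 hvp0, ?_⟩
    -- At a zero of v + τ the function x - τ does not vanish, so x + v has the same order as x - τ.
    -- The second factorisation then shows that y - τ vanishes at least to the order of v + τ, and
    -- (y - τ)/(v + τ) keeps only the poles of y.
    suffices hle : ∀ P, (c - b) P ≤ O.ord P ((y - T) / (v + T)) from
      divisor_eq_of_le (by rw [map_sub, hb, hc, sub_self]) hle
    intro P
    rw [O.ord_div P hym0 hvp0, Finsupp.sub_apply]
    have haP := a0 P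
    have hbP := b0 P
    have hcP := c0 P
    have hc1 : max (-O.ord P (v + T)) 0 = c P := by rw [← hvp, poles_apply]
    have ha1 : max (-O.ord P (x - T)) 0 = a P := by rw [← hxm, poles_apply]
    have ha2 : max (-O.ord P (x + T)) 0 = a P := by rw [← hxp, poles_apply]
    have hb1 : max (-O.ord P (y - T)) 0 = b P := by rw [← hym, poles_apply]
    have dab' := dab P
    have dbc' := dbc P
    rcases lt_or_ge 0 (O.ord P (v + T)) with hz | hz
    · have hxT := hcommon P hz
      have h1 : O.ord P (x + v) = O.ord P (x - T) := by
        have := (ord_add_eq (O := O) (P := P) (f := x - T) (g := v + T) hxm0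
          (fun _ => by omega)).2
        rwa [show x - T + (v + T) = x + v by ring] at this
      have h2 := congrArg (O.ord P) hid2
      rw [O.ord_neg, O.ord_mul P hym0 hxv0, O.ord_mul P hvp0 hxp0] at h2
      omega
    · omega

/-- Two of three affine functions in a quadratic relation have linearly equivalent poles, or the
relation can be normalised. -/
lemma exists_affine_of_relation [IsAlgClosed k] [CharZero k] {x y v : K}
    {p q r l m n t : k} (hp : p ≠ 0) (hq : q ≠ 0) (hr : r ≠ 0)
    (h : algebraMap k K p * (x * y) + algebraMap k K q * (x * v) + algebraMap k K r * (y * v) +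
      algebraMap k K l * x + algebraMap k K m * y + algebraMap k K n * v + algebraMap k K t = 0) :
    ∃ (c₁ c₂ c₃ d₁ d₂ d₃ τ : k), c₁ ≠ 0 ∧ c₂ ≠ 0 ∧ c₃ ≠ 0 ∧
      (algebraMap k K c₁ * x + algebraMap k K d₁) * (algebraMap k K c₂ * y + algebraMap k K d₂) +
      (algebraMap k K c₂ * y + algebraMap k K d₂) * (algebraMap k K c₃ * v + algebraMap k K d₃) +
      (algebraMap k K c₃ * v + algebraMap k K d₃) * (algebraMap k K c₁ * x + algebraMap k K d₁) =
        -(algebraMap k K τ) ^ 2 := by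
  -- Multiplied by pqr, the relation has the quadratic part of the normal form in pqx, pry, qrv. The
  -- linear terms match when d₂ + d₃ = lr, d₁ + d₃ = mq, d₁ + d₂ = np, which are solved by halving;
  -- -τ² collects the constants.
  set d₁ := (m * q + n * p - l * r) / 2 with hd₁
  set d₂ := (l * r + n * p - m * q) / 2 with hd₂
  set d₃ := (l * r + m * q - n * p) / 2 with hd₃
  obtain ⟨τ, hτ⟩ := IsAlgClosed.exists_pow_nat_eq
    (p * q * r * t - (d₁ * d₂ + d₂ * d₃ + d₃ * d₁)) (n := 2) two_pos
  refine ⟨p * q, p * r, q * r, d₁, d₂, d₃, τ, mul_ne_zero hp hq, mul_ne_zero hp hr,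
    mul_ne_zero hq hr, ?_⟩
  have e1 : d₂ + d₃ = l * r := by rw [hd₂, hd₃]; ring
  have e2 : d₁ + d₃ = m * q := by rw [hd₁, hd₃]; ring
  have e3 : d₁ + d₂ = n * p := by rw [hd₁, hd₂]; ring
  have e1' := congrArg (algebraMap k K) e1
  have e2' := congrArg (algebraMap k K) e2
  have e3' := congrArg (algebraMap k K) e3
  have hτ' := congrArg (algebraMap k K) hτ
  simp only [map_mul, map_add, map_sub, map_pow] at *
  linear_combination algebraMap k K p * algebraMap k K q * algebraMap k K r * h + hτ' +
    algebraMap k K p * algebraMap k K q * x * e1' +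
    algebraMap k K p * algebraMap k K r * y * e2' +
    algebraMap k K q * algebraMap k K r * v * e3'

end OrderSystem

/-! ### The five-term relation and the generators in the quotient -/

namespace PreBloch

variable {K : Type*} [Field K]

lemma cls_five_term (x y : Gen K) (h : x ≠ y) :
    cls x - cls y + cls (arg₁ x y h) + cls (arg₂ x y h) - cls (arg₃ x y h) = 0 :=
  (QuotientAddGroup.eq_zero_iff (fiveTerm x y h)).2 (AddSubgroup.subset_closure ⟨x, y, h, rfl⟩)

lemma closure_cls : AddSubgroup.closure (Set.range (cls : Gen K → B₂ K)) = ⊤ := by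
  rw [eq_top_iff]
  rintro x -
  obtain ⟨x, rfl⟩ := QuotientAddGroup.mk_surjective x
  induction x using FreeAbelianGroup.induction_on with
  | zero => exact zero_mem _
  | of x => exact AddSubgroup.subset_closure ⟨x, rfl⟩
  | neg x hx => exact neg_mem hx
  | add x y hx hy => exact add_mem hx hy

end PreBloch

/-! ### Descent by the five-term relation -/

namespace OrderSystem

open Finsupp Module PreBloch

variable {k K Pt : Type*} [Field k] [Field K] [Algebra k K] {O : OrderSystem k K Pt}

/-- Five-term relation for two functions that share many zeros, poles and points of value `1`. -/
lemma cls_mem_of_common {H : AddSubgroup (B₂ K)} {f g : Gen K}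
    (hH : ∀ h : Gen K, (O.zeros h.1).degree < (O.zeros f.1).degree → cls h ∈ H)
    (hgf : (O.zeros g.1).degree < (O.zeros f.1).degree) {a b c : Pt →₀ ℤ}
    (haf : ∀ P, a P ≤ O.zeros f.1 P) (hag : ∀ P, a P ≤ O.zeros g.1 P)
    (hbf : ∀ P, b P ≤ O.poles f.1 P) (hbg : ∀ P, b P ≤ O.poles g.1 P)
    (hcf : ∀ P, c P ≤ O.zeros (1 - f.1) P) (hcg : ∀ P, c P ≤ O.zeros (1 - g.1) P)
    (hab : (O.zeros g.1).degree < a.degree + b.degree)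
    (hbc : (O.zeros g.1).degree < b.degree + c.degree)
    (hac : (O.zeros g.1).degree < a.degree + c.degree) : cls f ∈ H := by
  have hne : f ≠ g := by
    rintro rfl
    exact lt_irrefl _ hgf
  have hf0 := f.2.1
  have hg0 := g.2.1
  have hf1 : 1 - f.1 ≠ 0 := sub_ne_zero.2 f.2.2.symm
  have hg1 : 1 - g.1 ≠ 0 := sub_ne_zero.2 g.2.2.symm
  have pf : ∀ P, max (-O.ord P (1 - f.1)) 0 = max (-O.ord P f.1) 0 := fun P => by
    rw [← poles_apply, poles_one_sub, poles_apply]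
  have pg : ∀ P, max (-O.ord P (1 - g.1)) 0 = max (-O.ord P g.1) 0 := fun P => by
    rw [← poles_apply, poles_one_sub, poles_apply]
  -- In each of the three quotients the zeros are bounded by two divisors, one of degree deg f and
  -- one of degree deg g, from each of which a common part can be removed: a and b here, c and b
  -- next, c and a last.
  have h1 : cls (arg₁ f g hne) ∈ H := by
    refine hH _ (lt_of_le_of_lt (degree_le_degree
      (D' := (O.zeros g.1 - a) + (O.poles f.1 - b)) fun P => ?_) ?_)
    · have e : O.ord P (arg₁ f g hne).1 = O.ord P g.1 - O.ord P f.1 := O.ord_div P hg0 hf0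
      have := haf P
      have := hag P
      have := hbf P
      have := hbg P
      simp only [Finsupp.add_apply, Finsupp.sub_apply, zeros_apply, poles_apply, e] at *
      omega
    · rw [map_add, map_sub, map_sub, O.degree_poles]
      omega
  have h2 : cls (arg₂ f g hne) ∈ H := by
    refine hH _ (lt_of_le_of_lt (degree_le_degree
      (D' := (O.zeros (1 - f.1) - c) + (O.poles g.1 - b)) fun P => ?_) ?_)
    · have e : O.ord P (arg₂ f g hne).1 = O.ord P (1 - f.1) - O.ord P (1 - g.1) :=
        O.ord_div P hf1 hg1
      have := hcf P
      have := hcg P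
      have := hbf P
      have := hbg P
      have := pf P
      have := pg P
      simp only [Finsupp.add_apply, Finsupp.sub_apply, zeros_apply, poles_apply, e] at *
      omega
    · rw [map_add, map_sub, map_sub, O.degree_poles, degree_zeros_one_sub]
      omega
  have h3 : cls (arg₃ f g hne) ∈ H := by
    refine hH _ (lt_of_le_of_lt (degree_le_degree
      (D' := (O.zeros (1 - f.1) - c) + (O.zeros g.1 - a)) fun P => ?_) ?_)
    · have e0 : (arg₃ f g hne).1 = ((1 - f.1) * g.1) / (f.1 * (1 - g.1)) := by
        have hg2 : g.1 - 1 ≠ 0 := sub_ne_zero.2 g.2.2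
        have : (1 - f.1⁻¹) / (1 - g.1⁻¹) = ((1 - f.1) * g.1) / (f.1 * (1 - g.1)) := by
          field_simp
          ring
        exact this
      have e : O.ord P (arg₃ f g hne).1 =
          O.ord P (1 - f.1) + O.ord P g.1 - (O.ord P f.1 + O.ord P (1 - g.1)) := by
        rw [e0, O.ord_div P (mul_ne_zero hf1 hg0) (mul_ne_zero hf0 hg1), O.ord_mul P hf1 hg0,
          O.ord_mul P hf0 hg1]
      have := hcf P
      have := hcg P
      have := haf P
      have := hag P
      have := pf P
      have := pg P
      simp only [Finsupp.add_apply, Finsupp.sub_apply, zeros_apply, e] at *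
      omega
    · rw [map_add, map_sub, map_sub, degree_zeros_one_sub]
      omega
  have h4 : cls f = cls g - cls (arg₁ f g hne) - cls (arg₂ f g hne) + cls (arg₃ f g hne) := by
    rw [← sub_eq_zero, ← cls_five_term f g hne]
    abel
  rw [h4]
  exact add_mem (sub_mem (sub_mem (hH g hgf) h1) h2) h3

lemma exists_value {f : K} {P : Pt} (hf : O.ord P f = 0) (hc : ∀ c : k, f ≠ algebraMap k K c) :
    ∃ e : k, e ≠ 0 ∧ f - algebraMap k K e ≠ 0 ∧ 0 < O.ord P (f - algebraMap k K e) := by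
  obtain ⟨e, he⟩ := O.exists_residue P (by simpa using hc 0) hf
  refine ⟨e, ?_, sub_ne_zero.2 (hc e), he (hc e)⟩
  rintro rfl
  have := he (hc 0)
  rw [map_zero, sub_zero] at this
  omega

lemma poles_eq_of_ord_eq {u : K} {a b : Pt →₀ ℤ} (hu : ∀ P, O.ord P u = a P - b P)
    (ha : ∀ P, 0 ≤ a P) (hb : ∀ P, 0 ≤ b P) (dab : Disj a b) : O.poles u = b := by
  ext P
  have := hu P
  have := ha P
  have := hb P
  have := dab P
  rw [poles_apply]
  omega

/-- A function whose divisor is `a - b` gives a function of degree `2` to be used in a five-term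
relation when two of the pairs of zeros, poles and points of value `1` are linearly equivalent. -/
lemma cls_mem_of_linEquiv {H : AddSubgroup (B₂ K)} {f : Gen K}
    (hH : ∀ h : Gen K, (O.zeros h.1).degree < (O.zeros f.1).degree → cls h ∈ H)
    (hf : 2 < (O.zeros f.1).degree) {a b c : Pt →₀ ℤ}
    (ha0 : ∀ P, 0 ≤ a P) (hb0 : ∀ P, 0 ≤ b P) (hc0 : ∀ P, 0 ≤ c P)
    (ha : a.degree = 2) (hb : b.degree = 2) (hc : c.degree = 2)
    (dab : Disj a b) (dac : Disj a c) (dbc : Disj b c)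
    (haf : ∀ P, a P ≤ O.zeros f.1 P) (hbf : ∀ P, b P ≤ O.poles f.1 P)
    (hcf : ∀ P, c P ≤ O.zeros (1 - f.1) P)
    (h : O.LinEquiv a b ∨ O.LinEquiv a c ∨ O.LinEquiv b c) : cls f ∈ H := by
  have pos : ∀ {d : Pt →₀ ℤ}, d.degree = 2 → 0 < d.degree := fun h => by rw [h]; norm_num
  rcases h with ⟨u, hu0, hu⟩ | ⟨u, hu0, hu⟩ | ⟨u, hu0, hu⟩
  -- For div u = a - b, scaling u to the value 1 at a point P of c gives degree 2, with all of a and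
  -- b in common and one point of c.
  · have hpu := poles_eq_of_ord_eq hu ha0 hb0 dab
    have huc := ne_const_of_poles_eq hpu (pos hb)
    obtain ⟨P, hP⟩ := exists_pos_of_degree_pos (pos hc)
    have hPa := (dac P).resolve_right hP.ne'
    have hPb := (dbc P).resolve_right hP.ne'
    obtain ⟨e, he, hw0, hw⟩ := exists_value (O := O) (P := P) (by rw [hu, hPa, hPb, sub_zero]) huc
    have he' : algebraMap k K e ≠ 0 := by simpa using he
    have hord : ∀ Q, O.ord Q (u / algebraMap k K e) = a Q - b Q := fun Q => by
      rw [O.ord_div Q hu0 he', hu, O.ord_algebraMap, sub_zero]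
    have h1g : 1 - u / algebraMap k K e = -((u - algebraMap k K e) / algebraMap k K e) := by
      field_simp
      ring
    have hz : O.zeros (u / algebraMap k K e) = a := by
      ext Q
      have := ha0 Q
      have := hb0 Q
      have := dab Q
      rw [zeros_apply, hord]
      omega
    have hp := poles_eq_of_ord_eq hord ha0 hb0 dab
    refine cls_mem_of_common (O := O) (H := H) (f := f) (a := a) (b := b) (c := single P 1)
      (g := ⟨u / algebraMap k K e, div_ne_zero hu0 he', fun h => huc e ((div_eq_one_iff_eq he').1 h)⟩)
      hH ?_ haf ?_ hbf ?_ (fun Q => (single_one_le hc0 hP Q).trans (hcf Q))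
      (single_one_le (fun Q => ?_) ?_) ?_ ?_ ?_ <;> dsimp only
    · rw [hz, ha]
      exact hf
    · rw [hz]
      exact fun _ => le_rfl
    · rw [hp]
      exact fun _ => le_rfl
    · rw [zeros_apply]
      exact le_max_right _ _
    · rw [h1g, zeros_apply, O.ord_neg, O.ord_div P hw0 he', O.ord_algebraMap]
      omega
    · rw [hz, ha, hb]
      norm_num
    · rw [hz, ha, hb, degree_single]
      norm_num
    · rw [hz, ha, degree_single]
      norm_num
  -- For div u = a - c and e the value of u at a point P of b, take g = u/(u - e): it vanishes on a,
  -- has a pole at P and equals 1 at the poles c of u.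
  · have hpu := poles_eq_of_ord_eq hu ha0 hc0 dac
    have huc := ne_const_of_poles_eq hpu (pos hc)
    obtain ⟨P, hP⟩ := exists_pos_of_degree_pos (pos hb)
    have hPa := (dab P).resolve_right hP.ne'
    have hPc := (dbc P).resolve_left hP.ne'
    obtain ⟨e, he, hw0, hw⟩ := exists_value (O := O) (P := P) (by rw [hu, hPa, hPc, sub_zero]) huc
    have he' : algebraMap k K e ≠ 0 := by simpa using he
    have hpw := poles_sub_const hpu e
    set w := u - algebraMap k K e with hw'
    have hord : ∀ Q, O.ord Q (u / w) = a Q - c Q - O.ord Q w := fun Q => by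
      rw [O.ord_div Q hu0 hw0, hu]
    have hpw' : ∀ Q, max (-O.ord Q w) 0 = c Q := fun Q => by rw [← poles_apply, hpw]
    have h1g : 1 - u / w = -(algebraMap k K e / w) := by
      field_simp
      rw [hw']
      ring
    have haw : ∀ Q, 0 < a Q → O.ord Q w = 0 := fun Q hQ => by
      rw [hw', O.ord_sub_comm, sub_eq_add_neg, (ord_add_eq he' ?_).2, O.ord_algebraMap]
      rw [O.ord_algebraMap]
      intro _
      have := (dac Q).resolve_left hQ.ne'
      rw [O.ord_neg, hu]
      omega
    have hz : (O.zeros (u / w)).degree ≤ 2 := by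
      rw [← ha]
      refine degree_le_degree fun Q => ?_
      have := hpw' Q
      have := ha0 Q
      rw [zeros_apply, hord]
      omega
    refine cls_mem_of_common (O := O) (H := H) (f := f) (a := a) (b := single P 1) (c := c)
      (g := ⟨u / w, div_ne_zero hu0 hw0, fun h => ?_⟩)
      hH (hz.trans_lt hf) haf (fun Q => ?_) (fun Q => (single_one_le hb0 hP Q).trans (hbf Q))
      (single_one_le (poles_nonneg _) ?_) hcf (fun Q => ?_) ?_ ?_ ?_
    · rw [div_eq_one_iff_eq hw0, hw'] at h
      exact he' (by linear_combination h)
    · have := ha0 Q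
      have := haw Q
      have := dac Q
      rw [zeros_apply, hord]
      omega
    · rw [poles_apply, hord]
      omega
    · have := hpw' Q
      have := hc0 Q
      rw [h1g, zeros_apply, O.ord_neg, O.ord_div Q he' hw0, O.ord_algebraMap]
      omega
    all_goals
      simp only [degree_single, ha, hc]
      linarith
  -- For div u = b - c and e the value of u at a point P of a, take g = (u - e)/u: it vanishes at P,
  -- has poles on b and equals 1 at the poles c of u.
  · have hpu := poles_eq_of_ord_eq hu hb0 hc0 dbc
    have huc := ne_const_of_poles_eq hpu (pos hc)
    obtain ⟨P, hP⟩ := exists_pos_of_degree_pos (pos ha)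
    have hPb := (dab P).resolve_left hP.ne'
    have hPc := (dac P).resolve_left hP.ne'
    obtain ⟨e, he, hw0, hw⟩ := exists_value (O := O) (P := P) (by rw [hu, hPb, hPc, sub_zero]) huc
    have he' : algebraMap k K e ≠ 0 := by simpa using he
    have hpw := poles_sub_const hpu e
    set w := u - algebraMap k K e with hw'
    have hord : ∀ Q, O.ord Q (w / u) = O.ord Q w - (b Q - c Q) := fun Q => by
      rw [O.ord_div Q hw0 hu0, hu]
    have hpw' : ∀ Q, max (-O.ord Q w) 0 = c Q := fun Q => by rw [← poles_apply, hpw]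
    have h1g : 1 - w / u = algebraMap k K e / u := by
      field_simp
      rw [hw']
      ring
    have hbw : ∀ Q, 0 < b Q → O.ord Q w = 0 := fun Q hQ => by
      rw [hw', O.ord_sub_comm, sub_eq_add_neg, (ord_add_eq he' ?_).2, O.ord_algebraMap]
      rw [O.ord_algebraMap]
      intro _
      have := (dbc Q).resolve_left hQ.ne'
      rw [O.ord_neg, hu]
      omega
    have hz : (O.zeros (w / u)).degree ≤ 2 := by
      rw [← hb, ← O.degree_poles]
      refine degree_le_degree fun Q => ?_
      have := hpw' Q
      have := hb0 Q
      rw [poles_apply, hord]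
      omega
    refine cls_mem_of_common (O := O) (H := H) (f := f) (a := single P 1) (b := b) (c := c)
      (g := ⟨w / u, div_ne_zero hw0 hu0, fun h => ?_⟩)
      hH (hz.trans_lt hf) (fun Q => (single_one_le ha0 hP Q).trans (haf Q))
      (single_one_le (fun Q => ?_) ?_) hbf (fun Q => ?_) hcf (fun Q => ?_) ?_ ?_ ?_
    · rw [div_eq_one_iff_eq hu0, hw'] at h
      exact he' (by linear_combination -h)
    · rw [zeros_apply]
      exact le_max_right _ _
    · rw [zeros_apply, hord]
      omega
    · have := hb0 Q
      have := hbw Q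
      have := dbc Q
      rw [poles_apply, hord]
      omega
    · have := hpw' Q
      have := hc0 Q
      have := hb0 Q
      have := dbc Q
      rw [h1g, zeros_apply, O.ord_div Q he' hu0, O.ord_algebraMap, hu]
      omega
    all_goals
      simp only [degree_single, hb, hc]
      linarith

end OrderSystem

/-! ### The quadratic relation and the induction on the degree -/

namespace OrderSystem

open Finsupp Module PreBloch

variable {k K Pt : Type*} [Field k] [Field K] [Algebra k K] {O : OrderSystem k K Pt}

/-- At a pole of x the functions y and v are regular, so nothing could cancel the pole of lx. -/
lemma eq_zero_of_linear_relation {x y v : K} {a b c : Pt →₀ ℤ} (hx : O.poles x = a)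
    (hy : O.poles y = b) (hv : O.poles v = c) (ha : 0 < a.degree) (dab : Disj a b)
    (dac : Disj a c) {l m n t : k}
    (h : algebraMap k K l * x + algebraMap k K m * y + algebraMap k K n * v + algebraMap k K t = 0) :
    l = 0 := by
  by_contra hl
  obtain ⟨P, hP⟩ := exists_pos_of_degree_pos ha
  have hbP := (dab P).resolve_left hP.ne'
  have hcP := (dac P).resolve_left hP.ne'
  have hx0 : x ≠ 0 := by simpa using ne_const_of_poles_eq hx ha 0
  have hyP := vanishes_of_poles_eq hy P
  have hvP := vanishes_of_poles_eq hv P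
  rw [hbP, neg_zero] at hyP
  rw [hcP, neg_zero] at hvP
  have h1 := ((hyP.const_mul m).add (hvP.const_mul n)).add (O.vanishes_const P t)
  refine (ord_add_eq (O := O) (P := P) (mul_ne_zero ((map_ne_zero (algebraMap k K)).2 hl) hx0) (h1.mono ?_)).1
    (by rw [← h]; ring)
  rw [O.ord_const_mul P hl, ord_eq_of_poles_eq hx hP]
  omega

/-- A dimension count: seven functions in a space of dimension at most 6. The relation is genuinely
quadratic because x, y, v, 1 are independent, their poles being disjoint. -/
lemma exists_quadric (hO : O.IsGenusOne) {x y v : K} {a b c : Pt →₀ ℤ} (hx : O.poles x = a)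
    (hy : O.poles y = b) (hv : O.poles v = c)
    (ha : ∃ P Q : Pt, a = single P 1 + single Q 1) (hb : ∃ P Q : Pt, b = single P 1 + single Q 1)
    (hc : ∃ P Q : Pt, c = single P 1 + single Q 1)
    (dab : Disj a b) (dac : Disj a c) (dbc : Disj b c) :
    ∃ p q r l m n t : k, (p ≠ 0 ∨ q ≠ 0 ∨ r ≠ 0) ∧
      algebraMap k K p * (x * y) + algebraMap k K q * (x * v) + algebraMap k K r * (y * v) +
        algebraMap k K l * x + algebraMap k K m * y + algebraMap k K n * v +
        algebraMap k K t = 0 := by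
  have a0 : ∀ P, 0 ≤ a P := fun P => hx ▸ poles_nonneg x P
  have b0 : ∀ P, 0 ≤ b P := fun P => hy ▸ poles_nonneg y P
  have c0 : ∀ P, 0 ≤ c P := fun P => hv ▸ poles_nonneg v P
  have hrank : Module.Finite k (O.space (a + b + c)) ∧
      finrank k (O.space (a + b + c)) ≤ 6 := by
    obtain ⟨P₁, P₂, rfl⟩ := ha
    obtain ⟨P₃, P₄, rfl⟩ := hb
    obtain ⟨P₅, P₆, rfl⟩ := hc
    -- The base point P₁ accounts for one dimension and the five other points for at most one each.
    simpa only [Multiset.insert_eq_cons, Multiset.card_cons, Multiset.card_singleton] using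
      hO.finrank_space_le {P₂, P₃, P₄, P₅, P₆} P₁ (by simp [add_assoc])
  have vx := vanishes_of_poles_eq hx
  have vy := vanishes_of_poles_eq hy
  have vv := vanishes_of_poles_eq hv
  have mono : ∀ {f : K} {n : Pt → ℤ}, (∀ P, O.Vanishes P (n P) f) →
      (∀ P, -(a P + b P + c P) ≤ n P) → f ∈ O.space (a + b + c) := fun hf hn P =>
    (hf P).mono (by simpa only [Finsupp.add_apply] using hn P)
  have m1 : x * y ∈ O.space (a + b + c) := mono (fun P => (vx P).mul (vy P)) fun P => by
    have := c0 P; omega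
  have m2 : x * v ∈ O.space (a + b + c) := mono (fun P => (vx P).mul (vv P)) fun P => by
    have := b0 P; omega
  have m3 : y * v ∈ O.space (a + b + c) := mono (fun P => (vy P).mul (vv P)) fun P => by
    have := a0 P; omega
  have m4 : x ∈ O.space (a + b + c) := mono vx fun P => by
    have := b0 P; have := c0 P; omega
  have m5 : y ∈ O.space (a + b + c) := mono vy fun P => by
    have := a0 P; have := c0 P; omega
  have m6 : v ∈ O.space (a + b + c) := mono vv fun P => by
    have := a0 P; have := b0 P; omega
  have m7 : (1 : K) ∈ O.space (a + b + c) := mono (n := 0) (fun P _ => (O.ord_one P).ge) fun P => by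
    have := a0 P; have := b0 P; have := c0 P; simp only [Pi.zero_apply]; omega
  let w : Fin 7 → O.space (a + b + c) :=
    ![⟨_, m1⟩, ⟨_, m2⟩, ⟨_, m3⟩, ⟨_, m4⟩, ⟨_, m5⟩, ⟨_, m6⟩, ⟨_, m7⟩]
  have hdep : ¬ LinearIndependent k w := fun hw => by
    have := hrank.1
    have h1 := hw.fintype_card_le_finrank
    rw [Fintype.card_fin] at h1
    have h2 := hrank.2
    omega
  obtain ⟨g, hg, i, hi⟩ := Fintype.not_linearIndependent_iff.1 hdep
  have hg' : algebraMap k K (g 0) * (x * y) + algebraMap k K (g 1) * (x * v) +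
      algebraMap k K (g 2) * (y * v) + algebraMap k K (g 3) * x + algebraMap k K (g 4) * y +
      algebraMap k K (g 5) * v + algebraMap k K (g 6) = 0 := by
    have := congrArg (O.space (a + b + c)).subtype hg
    simpa [Fin.sum_univ_succ, w, Algebra.smul_def, ← add_assoc] using this
  refine ⟨g 0, g 1, g 2, g 3, g 4, g 5, g 6, ?_, hg'⟩
  by_contra! hpqr
  obtain ⟨h0, h1, h2⟩ := hpqr
  have pos : ∀ {d : Pt →₀ ℤ}, (∃ P Q : Pt, d = single P 1 + single Q 1) → 0 < d.degree := by
    rintro d ⟨P, Q, rfl⟩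
    simp
  simp only [h0, h1, h2, map_zero, zero_mul, zero_add] at hg'
  have h3 := eq_zero_of_linear_relation hx hy hv (pos ha) dab dac hg'
  have h4 := eq_zero_of_linear_relation hy hx hv (pos hb) dab.symm dbc (l := g 4) (m := g 3)
    (n := g 5) (t := g 6) (by rw [← hg']; ring)
  have h5 := eq_zero_of_linear_relation hv hx hy (pos hc) dac.symm dbc.symm (l := g 5) (m := g 3)
    (n := g 4) (t := g 6) (by rw [← hg']; ring)
  simp only [h3, h4, h5, map_zero, zero_mul, zero_add] at hg'
  have h6 : g 6 = 0 := by simpa using hg'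
  fin_cases i <;> simp_all

/-- The inductive step. Degree at least 4 makes every intermediate function strictly smaller: the
interpolating g has degree at most 3, less than the total degree 4 of any two of the pairs. -/
lemma cls_mem_of_lt [IsAlgClosed k] [CharZero k] (hO : O.IsGenusOne) {H : AddSubgroup (B₂ K)}
    {f : Gen K} (hH : ∀ h : Gen K, (O.zeros h.1).degree < (O.zeros f.1).degree → cls h ∈ H)
    (hf : 3 < (O.zeros f.1).degree) : cls f ∈ H := by
  obtain ⟨P₁, P₂, haf⟩ := exists_single_add_single_le (D := O.zeros f.1) (by simp) (by linarith)
  obtain ⟨P₃, P₄, hbf⟩ := exists_single_add_single_le (D := O.poles f.1) (by simp)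
    (by rw [O.degree_poles]; linarith)
  obtain ⟨P₅, P₆, hcf⟩ := exists_single_add_single_le (D := O.zeros (1 - f.1)) (by simp)
    (by rw [degree_zeros_one_sub]; linarith)
  have nonneg : ∀ P Q R : Pt, 0 ≤ (single P 1 + single Q 1 : Pt →₀ ℤ) R := fun P Q R =>
    add_nonneg (single_one_apply_nonneg P R) (single_one_apply_nonneg Q R)
  have deg : ∀ P Q : Pt, (single P 1 + single Q 1 : Pt →₀ ℤ).degree = 2 := fun P Q => by
    simp
  have ha0 := nonneg P₁ P₂
  have hb0 := nonneg P₃ P₄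
  have hc0 := nonneg P₅ P₆
  have ha := deg P₁ P₂
  have hb := deg P₃ P₄
  have hc := deg P₅ P₆
  have ha2 : ∃ P Q : Pt, (single P₁ 1 + single P₂ 1 : Pt →₀ ℤ) = single P 1 + single Q 1 :=
    ⟨_, _, rfl⟩
  have hb2 : ∃ P Q : Pt, (single P₃ 1 + single P₄ 1 : Pt →₀ ℤ) = single P 1 + single Q 1 :=
    ⟨_, _, rfl⟩
  have hc2 : ∃ P Q : Pt, (single P₅ 1 + single P₆ 1 : Pt →₀ ℤ) = single P 1 + single Q 1 :=
    ⟨_, _, rfl⟩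
  generalize (single P₁ 1 + single P₂ 1 : Pt →₀ ℤ) = a at *
  generalize (single P₃ 1 + single P₄ 1 : Pt →₀ ℤ) = b at *
  generalize (single P₅ 1 + single P₆ 1 : Pt →₀ ℤ) = c at *
  have hf1 : 1 - f.1 ≠ 0 := sub_ne_zero.2 f.2.2.symm
  have dab : Disj a b := fun P => by
    have h1 := haf P
    have h2 := hbf P
    have h3 := ha0 P
    have h4 := hb0 P
    simp only [zeros_apply, poles_apply] at h1 h2
    omega
  have dbc : Disj b c := fun P => by
    have h1 := hbf P
    have h2 := hcf P
    have h3 := hb0 P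
    have h4 := hc0 P
    rw [← poles_one_sub] at h1
    simp only [zeros_apply, poles_apply] at h1 h2
    omega
  have dac : Disj a c := fun P => by
    have h1 := haf P
    have h2 := hcf P
    have h3 := ha0 P
    have h4 := hc0 P
    simp only [zeros_apply] at h1 h2
    -- A common zero of f and 1 - f would be a zero of their sum 1.
    by_contra! hP
    have h5 : O.Vanishes P 1 f.1 := fun _ => by omega
    have h6 : O.Vanishes P 1 (1 - f.1) := fun _ => by omega
    have h7 := (h6.add h5) (by simp)
    rw [sub_add_cancel, O.ord_one] at h7
    omega
  have equiv := fun h => cls_mem_of_linEquiv hH (by linarith) ha0 hb0 hc0 ha hb hc dab dac dbc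
    haf hbf hcf h
  obtain ⟨x, hx⟩ := hO.exists_poles_eq ha2
  obtain ⟨y, hy⟩ := hO.exists_poles_eq hb2
  obtain ⟨v, hv⟩ := hO.exists_poles_eq hc2
  obtain ⟨p, q, r, l, m, n, t, hpqr, hrel⟩ :=
    exists_quadric hO hx hy hv ha2 hb2 hc2 dab dac dbc
  have pa : 0 < a.degree := by omega
  have pb : 0 < b.degree := by omega
  have pc : 0 < c.degree := by omega
  -- If one product is missing from the relation, another is present, and after reordering x, y, v
  -- it plays the role of xy in `linEquiv_of_relation`, the missing one that of yv.
  by_cases hp : p = 0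
  · by_cases hq : q = 0
    · have hr : r ≠ 0 := by tauto
      exact equiv <| .inr <| .inr <| linEquiv_of_relation (q := 0) (p := r) (l := n) (m := m)
        (n := l) (t := t) hv hy hx pc (by omega) dbc.symm dab.symm hr
        (by rw [← hrel, hp, hq]; simp; ring)
    · exact equiv <| .inr <| .inl <| linEquiv_of_relation (p := q) (q := r) (l := n) (m := l)
        (n := m) (t := t) hv hx hy pc (by omega) dac.symm dab hq
        (by rw [← hrel, hp]; simp; ring)
  by_cases hq : q = 0
  · exact equiv <| .inl <| linEquiv_of_relation (p := p) (q := r) (l := m) (m := l)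
      (n := n) (t := t) hy hx hv pb (by omega) dab.symm dac hp
      (by rw [← hrel, hq]; simp; ring)
  by_cases hr : r = 0
  · exact equiv <| .inl <| (linEquiv_of_relation (p := p) (q := q) (l := l) (m := m)
      (n := n) (t := t) hx hy hv pa (by omega) dab dbc hp
      (by rw [← hrel, hr]; simp)).symm
  obtain ⟨c₁, c₂, c₃, d₁, d₂, d₃, τ, h₁, h₂, h₃, hquad⟩ := exists_affine_of_relation hp hq hr hrel
  rcases exists_of_quadric ((O.poles_affine h₁ d₁ x).trans hx) ((O.poles_affine h₂ d₂ y).trans hy)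
    ((O.poles_affine h₃ d₃ v).trans hv) ha hb hc dab dac dbc hquad with
    h | ⟨g, hg0, hg1, hag, hbg, hcg, hg⟩
  · exact equiv (.inr (.inr h.symm))
  · exact cls_mem_of_common (g := ⟨g, hg0, hg1⟩) hH (by dsimp only; omega) haf hag hbf hbg hcf hcg
      (by dsimp only; omega) (by dsimp only; omega) (by dsimp only; omega)

/-- The pre-Bloch group of the function field of a curve of genus one is generated by the classes
of functions of degree at most `3`. -/
theorem IsGenusOne.closure_eq_top [IsAlgClosed k] [CharZero k] (hO : O.IsGenusOne) :
    AddSubgroup.closure {b : B₂ K | ∃ f : Gen K, (O.zeros f.1).degree ≤ 3 ∧ b = cls f} = ⊤ := by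
  set H := AddSubgroup.closure {b : B₂ K | ∃ f : Gen K, (O.zeros f.1).degree ≤ 3 ∧ b = cls f}
  suffices h : ∀ (n : ℕ) (f : Gen K), (O.zeros f.1).degree = n → cls f ∈ H by
    rw [eq_top_iff, ← closure_cls, AddSubgroup.closure_le]
    rintro _ ⟨f, rfl⟩
    have h0 : 0 ≤ (O.zeros f.1).degree := degree_nonneg_of_nonneg fun P => by simp
    exact h (O.zeros f.1).degree.toNat f (Int.toNat_of_nonneg h0).symm
  intro n
  induction n using Nat.strong_induction_on with
  | _ n ih =>
    intro f hf
    rcases le_or_gt (O.zeros f.1).degree 3 with h3 | h3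
    · exact AddSubgroup.subset_closure ⟨f, h3, rfl⟩
    · refine cls_mem_of_lt hO (fun h hh => ?_) h3
      have h0 : 0 ≤ (O.zeros h.1).degree := degree_nonneg_of_nonneg fun P => by simp
      exact ih (O.zeros h.1).degree.toNat (by omega) h (Int.toNat_of_nonneg h0).symm

end OrderSystem

/-! ### Discrete valuation subrings of a field of functions -/

/-- `t` generates the maximal ideal of the discrete valuation ring `A`, whose residue field is
`k` and whose field of fractions is `K`. -/
structure Subring.IsUniformizer (k : Type*) {K : Type*} [Field k] [Field K] [Algebra k K]
    (A : Subring K) (t : K) : Prop where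
  mem : t ∈ A
  ne_zero : t ≠ 0
  inv_notMem : t⁻¹ ∉ A
  algebraMap_mem : ∀ c : k, algebraMap k K c ∈ A
  inv_mem_or_div_mem : ∀ f ∈ A, f⁻¹ ∈ A ∨ f / t ∈ A
  exists_residue : ∀ f ∈ A, ∃ c : k, (f - algebraMap k K c) / t ∈ A
  isNoetherianRing : IsNoetherianRing A
  exists_div : ∀ f : K, ∃ a ∈ A, ∃ b ∈ A, b ≠ 0 ∧ f = a / b

namespace Subring

variable {k K : Type*} [Field k] [Field K] [Algebra k K] {A : Subring K} {t : K}

/-- The order of `f` with respect to the uniformizer `t` of the discrete valuation ring `A`. -/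
noncomputable def order (A : Subring K) (t f : K) : ℤ :=
  open scoped Classical in
  if h : f ≠ 0 ∧ ∃ n : ℤ, f / t ^ n ∈ A ∧ (f / t ^ n)⁻¹ ∈ A then h.2.choose else 0

lemma order_zero : A.order t 0 = 0 := by
  simp [order]

namespace IsUniformizer



lemma pow_mem (ht : A.IsUniformizer k t) {n : ℤ} (hn : 0 ≤ n) : t ^ n ∈ A := by
  lift n to ℕ using hn
  rw [zpow_natCast]
  exact A.pow_mem ht.mem n

lemma nonneg_of_zpow_mem (ht : A.IsUniformizer k t) {n : ℤ} (hn : t ^ n ∈ A) : 0 ≤ n := by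
  by_contra! h
  refine ht.inv_notMem ?_
  have := A.mul_mem hn (ht.pow_mem (n := -n - 1) (by omega))
  rwa [← zpow_add₀ ht.ne_zero, show n + (-n - 1) = -1 by ring, zpow_neg_one] at this

/-- In a Noetherian domain the non-unit t divides f only finitely often, and a quotient no longer
divisible by t is a unit. -/
lemma exists_pow_of_mem (ht : A.IsUniformizer k t) {f : K} (hf : f ∈ A) (hf0 : f ≠ 0) :
    ∃ n : ℤ, f / t ^ n ∈ A ∧ (f / t ^ n)⁻¹ ∈ A := by
  have := ht.isNoetherianRing
  have hfin : FiniteMultiplicity (⟨t, ht.mem⟩ : A) ⟨f, hf⟩ := by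
    refine FiniteMultiplicity.of_not_isUnit (fun hu => ht.inv_notMem ?_)
      (fun h => hf0 (congrArg Subtype.val h))
    obtain ⟨u, hu⟩ := hu.exists_right_inv
    have h1 : t * u.1 = 1 := congrArg Subtype.val hu
    rw [inv_eq_of_mul_eq_one_right h1]
    exact u.2
  obtain ⟨⟨g, hg⟩, hfg, hndvd⟩ := hfin.exists_eq_pow_mul_and_not_dvd
  set m := multiplicity (⟨t, ht.mem⟩ : A) ⟨f, hf⟩
  have h1 : f = t ^ m * g := congrArg Subtype.val hfg
  have h2 : f / t ^ (m : ℤ) = g := by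
    rw [h1, zpow_natCast, mul_div_cancel_left₀ _ (pow_ne_zero _ ht.ne_zero)]
  refine ⟨m, h2 ▸ hg, h2 ▸ (ht.inv_mem_or_div_mem g hg).resolve_right fun h => hndvd ?_⟩
  exact ⟨⟨g / t, h⟩, Subtype.ext (mul_div_cancel₀ g ht.ne_zero).symm⟩

lemma exists_pow (ht : A.IsUniformizer k t) {f : K} (hf0 : f ≠ 0) :
    ∃ n : ℤ, f / t ^ n ∈ A ∧ (f / t ^ n)⁻¹ ∈ A := by
  obtain ⟨a, ha, b, hb, hb0, rfl⟩ := ht.exists_div f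
  obtain ⟨m, hm, hm'⟩ := ht.exists_pow_of_mem ha (fun h => hf0 (by rw [h, zero_div]))
  obtain ⟨n, hn, hn'⟩ := ht.exists_pow_of_mem hb hb0
  have h : a / b / t ^ (m - n) = a / t ^ m * (b / t ^ n)⁻¹ := by
    rw [zpow_sub₀ ht.ne_zero]
    have := ht.ne_zero
    field_simp
  refine ⟨m - n, ?_, ?_⟩
  · rw [h]
    exact A.mul_mem hm hn'
  · rw [h, mul_inv, inv_inv]
    exact A.mul_mem hm' hn

lemma div_zpow_order_mem (ht : A.IsUniformizer k t) {f : K} (hf0 : f ≠ 0) :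
    f / t ^ A.order t f ∈ A ∧ (f / t ^ A.order t f)⁻¹ ∈ A := by
  rw [order, dif_pos ⟨hf0, ht.exists_pow hf0⟩]
  exact Exists.choose_spec (p := fun n : ℤ => f / t ^ n ∈ A ∧ (f / t ^ n)⁻¹ ∈ A) _

lemma zero_le_order_iff (ht : A.IsUniformizer k t) {f : K} (hf0 : f ≠ 0) :
    0 ≤ A.order t f ↔ f ∈ A := by
  obtain ⟨h1, h2⟩ := ht.div_zpow_order_mem hf0
  have ht0 := zpow_ne_zero (A.order t f) ht.ne_zero
  constructor
  · intro h
    have := A.mul_mem h1 (ht.pow_mem h)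
    rwa [div_mul_cancel₀ _ ht0] at this
  · intro h
    refine ht.nonneg_of_zpow_mem ?_
    have := A.mul_mem h h2
    rwa [inv_div, mul_div_cancel₀ _ hf0] at this

lemma order_eq (ht : A.IsUniformizer k t) {f : K} (hf0 : f ≠ 0) {n : ℤ} (h1 : f / t ^ n ∈ A)
    (h2 : (f / t ^ n)⁻¹ ∈ A) : A.order t f = n := by
  obtain ⟨h3, h4⟩ := ht.div_zpow_order_mem hf0
  have ht0 := ht.ne_zero
  refine le_antisymm ?_ ?_ <;> rw [← sub_nonneg] <;> refine ht.nonneg_of_zpow_mem ?_ <;>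
    rw [zpow_sub₀ ht0]
  · have := A.mul_mem h2 h3
    rwa [show (f / t ^ n)⁻¹ * (f / t ^ A.order t f) = t ^ n / t ^ A.order t f by field_simp] at this
  · have := A.mul_mem h1 h4
    rwa [show f / t ^ n * (f / t ^ A.order t f)⁻¹ = t ^ A.order t f / t ^ n by field_simp] at this

lemma order_mul (ht : A.IsUniformizer k t) {f g : K} (hf : f ≠ 0) (hg : g ≠ 0) :
    A.order t (f * g) = A.order t f + A.order t g := by
  obtain ⟨h1, h2⟩ := ht.div_zpow_order_mem hf
  obtain ⟨h3, h4⟩ := ht.div_zpow_order_mem hg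
  have h : f * g / t ^ (A.order t f + A.order t g) =
      f / t ^ A.order t f * (g / t ^ A.order t g) := by
    rw [zpow_add₀ ht.ne_zero, mul_div_mul_comm]
  refine ht.order_eq (mul_ne_zero hf hg) ?_ ?_ <;> rw [h]
  · exact A.mul_mem h1 h3
  · rw [mul_inv]
    exact A.mul_mem h2 h4

lemma order_self (ht : A.IsUniformizer k t) : A.order t t = 1 := by
  refine ht.order_eq ht.ne_zero ?_ ?_ <;> simp [div_self ht.ne_zero, A.one_mem]

lemma order_eq_zero (ht : A.IsUniformizer k t) {f : K} (h1 : f ∈ A) (h2 : f⁻¹ ∈ A) :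
    A.order t f = 0 := by
  by_cases hf : f = 0
  · rw [hf, order_zero]
  · exact ht.order_eq hf (by simpa using h1) (by simpa using h2)

lemma order_algebraMap (ht : A.IsUniformizer k t) (c : k) :
    A.order t (algebraMap k K c) = 0 :=
  ht.order_eq_zero (ht.algebraMap_mem c) (by rw [← map_inv₀]; exact ht.algebraMap_mem _)

lemma order_zpow (ht : A.IsUniformizer k t) (n : ℤ) : A.order t (t ^ n) = n := by
  have := zpow_ne_zero n ht.ne_zero
  refine ht.order_eq this ?_ ?_ <;> simp [div_self this, A.one_mem]

lemma le_order_iff (ht : A.IsUniformizer k t) {f : K} (hf : f ≠ 0) {n : ℤ} :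
    n ≤ A.order t f ↔ f / t ^ n ∈ A := by
  have h0 := zpow_ne_zero n ht.ne_zero
  rw [← ht.zero_le_order_iff (div_ne_zero hf h0), div_eq_mul_inv, ← zpow_neg,
    ht.order_mul hf (zpow_ne_zero _ ht.ne_zero), ht.order_zpow]
  constructor <;> intro h <;> linarith

lemma min_le_order_add (ht : A.IsUniformizer k t) {f g : K} (hf : f ≠ 0) (hg : g ≠ 0)
    (hfg : f + g ≠ 0) : min (A.order t f) (A.order t g) ≤ A.order t (f + g) := by
  rw [ht.le_order_iff hfg, add_div]
  exact A.add_mem ((ht.le_order_iff hf).1 (min_le_left _ _))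
    ((ht.le_order_iff hg).1 (min_le_right _ _))

lemma exists_pos_order_sub (ht : A.IsUniformizer k t) {f : K} (hf : f ≠ 0)
    (h : A.order t f = 0) :
    ∃ c : k, f ≠ algebraMap k K c → 0 < A.order t (f - algebraMap k K c) := by
  obtain ⟨c, hc⟩ := ht.exists_residue f ((ht.zero_le_order_iff hf).1 h.ge)
  refine ⟨c, fun hne => ?_⟩
  have : 1 ≤ A.order t (f - algebraMap k K c) :=
    (ht.le_order_iff (sub_ne_zero.2 hne)).2 (by simpa using hc)
  linarith

lemma div_mem_of_isUniformizer (ht : A.IsUniformizer k t) {t' : K}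
    (ht' : A.IsUniformizer k t') : t' / t ∈ A :=
  (ht.inv_mem_or_div_mem t' ht'.mem).resolve_left ht'.inv_notMem

/-- Two uniformizers divide each other, so they differ by a unit. Orders may therefore be computed
with whichever uniformizer is convenient at the point. -/
lemma order_congr (ht : A.IsUniformizer k t) {t' : K} (ht' : A.IsUniformizer k t') (f : K) :
    A.order t f = A.order t' f := by
  by_cases hf : f = 0
  · rw [hf, order_zero, order_zero]
  have h1 : A.order t' t = 1 := by
    refine ht'.order_eq ht.ne_zero ?_ ?_
    · simpa using ht'.div_mem_of_isUniformizer ht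
    · simpa using ht.div_mem_of_isUniformizer ht'
  obtain ⟨h2, h3⟩ := ht.div_zpow_order_mem hf
  have h4 := ht'.order_eq_zero h2 h3
  have h5 : A.order t' (t ^ A.order t f) = A.order t f := by
    refine ht'.order_eq (zpow_ne_zero _ ht.ne_zero) ?_ ?_
    · rw [← div_zpow]
      rcases le_total 0 (A.order t f) with h | h
      · lift A.order t f to ℕ using h with n
        rw [zpow_natCast]
        exact A.pow_mem (ht'.div_mem_of_isUniformizer ht) n
      · obtain ⟨n, hn⟩ := Int.exists_eq_neg_ofNat h
        rw [hn, zpow_neg, zpow_natCast, ← inv_pow, inv_div]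
        exact A.pow_mem (ht.div_mem_of_isUniformizer ht') n
    · rw [← div_zpow, ← inv_zpow, inv_div]
      rcases le_total 0 (A.order t f) with h | h
      · lift A.order t f to ℕ using h with n
        rw [zpow_natCast]
        exact A.pow_mem (ht.div_mem_of_isUniformizer ht') n
      · obtain ⟨n, hn⟩ := Int.exists_eq_neg_ofNat h
        rw [hn, zpow_neg, zpow_natCast, ← inv_pow, inv_div]
        exact A.pow_mem (ht'.div_mem_of_isUniformizer ht) n
  have h6 := ht'.order_mul (div_ne_zero hf (zpow_ne_zero (A.order t f) ht.ne_zero))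
    (zpow_ne_zero (A.order t f) ht.ne_zero)
  rw [div_mul_cancel₀ _ (zpow_ne_zero _ ht.ne_zero), h4, h5, zero_add] at h6
  exact h6.symm

/-- The ideal (t) is maximal, so A/(t) has length one; the length is additive on products and f is a
unit times a power of t. This identifies the valuation with the multiplicity defined by lengths. -/
lemma ringOrd_eq (ht : A.IsUniformizer k t) {f : K} (hf : f ∈ A) (hf0 : f ≠ 0) :
    Ring.ord A ⟨f, hf⟩ = (A.order t f).toNat := by
  have hmax : (Ideal.span {(⟨t, ht.mem⟩ : A)}).IsMaximal := by
    refine Ideal.isMaximal_iff.2 ⟨fun h => ?_, fun J x hJ hx hxJ => ?_⟩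
    · obtain ⟨y, hy⟩ := Ideal.mem_span_singleton.1 h
      have h1 : (1 : K) = t * y.1 := congrArg Subtype.val hy
      refine ht.inv_notMem ?_
      rw [inv_eq_of_mul_eq_one_right h1.symm]
      exact y.2
    · have h1 : x.1⁻¹ ∈ A := (ht.inv_mem_or_div_mem x.1 x.2).resolve_right fun h =>
        hx (Ideal.mem_span_singleton.2 ⟨⟨x.1 / t, h⟩,
          Subtype.ext (mul_div_cancel₀ x.1 ht.ne_zero).symm⟩)
      have hx0 : x.1 ≠ 0 := fun h => hx (by
        rw [show x = 0 from Subtype.ext h]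
        exact zero_mem _)
      have h2 := J.mul_mem_left ⟨x.1⁻¹, h1⟩ hxJ
      rwa [show (⟨x.1⁻¹, h1⟩ : A) * x = 1 from Subtype.ext (inv_mul_cancel₀ hx0)] at h2
  have h1 : Ring.ord A (⟨t, ht.mem⟩ : A) = 1 := by
    rw [Ring.ord, Module.length_eq_one_iff, isSimpleModule_iff_isCoatom]
    exact Ideal.isMaximal_def.1 hmax
  have h0 := (ht.zero_le_order_iff hf0).2 hf
  obtain ⟨h2, h3⟩ := ht.div_zpow_order_mem hf0
  have hu0 : f / t ^ A.order t f ≠ 0 := div_ne_zero hf0 (zpow_ne_zero _ ht.ne_zero)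
  have hu : IsUnit (⟨f / t ^ A.order t f, h2⟩ : A) :=
    IsUnit.of_mul_eq_one ⟨_, h3⟩ (Subtype.ext (mul_inv_cancel₀ hu0))
  have h4 : (⟨f, hf⟩ : A) = ⟨f / t ^ A.order t f, h2⟩ * ⟨t, ht.mem⟩ ^ (A.order t f).toNat := by
    refine Subtype.ext ?_
    change f = f / t ^ A.order t f * t ^ (A.order t f).toNat
    rw [← zpow_natCast, Int.toNat_of_nonneg h0,
      div_mul_cancel₀ _ (zpow_ne_zero _ ht.ne_zero)]
  have ht0 : (⟨t, ht.mem⟩ : A) ∈ nonZeroDivisors A :=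
    mem_nonZeroDivisors_of_ne_zero fun h => ht.ne_zero (congrArg Subtype.val h)
  rw [h4, Ring.ord_mul_of_isUnit_left hu, Ring.ord_pow ht0, h1, nsmul_eq_mul, mul_one]

end IsUniformizer

end Subring

/-! ### Forms on the Weierstrass curve and their values at points -/

namespace EllDegree

open WeierstrassCurve Polynomial

variable {k : Type*} [Field k] (W : Affine k)

/-- The coordinate function `x`. -/
noncomputable def xCoord : W.FunctionField :=
  algebraMap W.CoordinateRing W.FunctionField (Affine.CoordinateRing.mk W (C X))

/-- The coordinate function `y`. -/
noncomputable def yCoord : W.FunctionField :=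
  algebraMap W.CoordinateRing W.FunctionField (Affine.CoordinateRing.mk W X)

lemma genericCoords_eq : genericCoords W = ![xCoord W, yCoord W, 1] := rfl

/-- The value of a form in the affine coordinate ring. -/
noncomputable def formClass : MvPolynomial (Fin 3) k →+* W.CoordinateRing :=
  MvPolynomial.eval₂Hom (algebraMap k W.CoordinateRing)
    ![Affine.CoordinateRing.mk W (C X), Affine.CoordinateRing.mk W X, 1]

lemma algebraMap_formClass (A : MvPolynomial (Fin 3) k) :
    algebraMap W.CoordinateRing W.FunctionField (formClass W A) = formVal W A := by
  suffices h : (algebraMap W.CoordinateRing W.FunctionField).comp (formClass W) = formVal W from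
    RingHom.congr_fun h A
  refine MvPolynomial.ringHom_ext (fun c => ?_) fun i => ?_
  · simp [formClass, formVal, ← IsScalarTower.algebraMap_apply]
  · fin_cases i <;> simp [formClass, formVal, genericCoords]

lemma mk_C_C (c : k) : Affine.CoordinateRing.mk W (C (C c)) = algebraMap k W.CoordinateRing c := rfl

lemma algebraMap_field_apply (c : k) : algebraMap k W.FunctionField c =
    algebraMap W.CoordinateRing W.FunctionField (algebraMap k W.CoordinateRing c) :=
  IsScalarTower.algebraMap_apply _ _ _ _

lemma coord_equation : yCoord W ^ 2 + algebraMap k W.FunctionField W.a₁ * xCoord W * yCoord W +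
    algebraMap k W.FunctionField W.a₃ * yCoord W = xCoord W ^ 3 +
    algebraMap k W.FunctionField W.a₂ * xCoord W ^ 2 +
    algebraMap k W.FunctionField W.a₄ * xCoord W + algebraMap k W.FunctionField W.a₆ := by
  have h := congrArg (algebraMap W.CoordinateRing W.FunctionField)
    (show Affine.CoordinateRing.mk W (X ^ 2 + C (C W.a₁ * X + C W.a₃) * X -
      C (X ^ 3 + C W.a₂ * X ^ 2 + C W.a₄ * X + C W.a₆)) = 0 from AdjoinRoot.mk_self)
  simp only [map_add, map_sub, map_mul, map_pow, map_zero] at h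
  simp only [algebraMap_field_apply, xCoord, yCoord, ← mk_C_C]
  linear_combination h

section Evaluation

variable {W}

/-- Evaluation of the elements of the affine coordinate ring at a point. -/
noncomputable def evalAt {x y : k} (h : W.Equation x y) : W.CoordinateRing →+* k :=
  AdjoinRoot.lift (evalRingHom x) y (by rw [eval₂_evalRingHom]; exact h)

lemma evalAt_formClass {x y : k} (h : W.Equation x y) (A : MvPolynomial (Fin 3) k) :
    evalAt h (formClass W A) = MvPolynomial.eval ![x, y, 1] A := by
  suffices h : (evalAt h).comp (formClass W) = MvPolynomial.eval ![x, y, 1] from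
    RingHom.congr_fun h A
  refine MvPolynomial.ringHom_ext (fun c => ?_) fun i => ?_
  · simp [formClass, ← mk_C_C, evalAt]
  · fin_cases i <;> simp [formClass, evalAt]

end Evaluation

section Infinity

open Affine.CoordinateRing

/-- The norm of p + qY has degree max(2 deg p, 2 deg q + 3), with no cancellation because of parity.
It serves as a pole order at infinity before a valuation there is available. -/
lemma degree_norm_add_le (r s : W.CoordinateRing) :
    (Algebra.norm k[X] (r + s)).degree ≤
      max (Algebra.norm k[X] r).degree (Algebra.norm k[X] s).degree := by
  obtain ⟨p, q, rfl⟩ := exists_smul_basis_eq r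
  obtain ⟨p', q', rfl⟩ := exists_smul_basis_eq s
  have e : p • (1 : W.CoordinateRing) + q • mk W X + (p' • 1 + q' • mk W X) =
      (p + p') • 1 + (q + q') • mk W X := by
    rw [add_smul, add_smul]
    abel
  rw [e, degree_norm_smul_basis, degree_norm_smul_basis, degree_norm_smul_basis]
  refine max_le ?_ ?_
  · rcases le_max_iff.1 (degree_add_le p p') with h | h
    · exact le_max_of_le_left (le_max_of_le_left (nsmul_le_nsmul_right h 2))
    · exact le_max_of_le_right (le_max_of_le_left (nsmul_le_nsmul_right h 2))
  · rcases le_max_iff.1 (degree_add_le q q') with h | h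
    · exact le_max_of_le_left (le_max_of_le_right
        (add_le_add_left (nsmul_le_nsmul_right h 2) 3))
    · exact le_max_of_le_right (le_max_of_le_right
        (add_le_add_left (nsmul_le_nsmul_right h 2) 3))

lemma degree_norm_sum_lt {ι : Type*} (s : Finset ι) (f : ι → W.CoordinateRing) {n : WithBot ℕ}
    (hn : ⊥ < n) (h : ∀ i ∈ s, (Algebra.norm k[X] (f i)).degree < n) :
    (Algebra.norm k[X] (∑ i ∈ s, f i)).degree < n := by
  classical
  induction s using Finset.induction_on with
  | empty =>
    have h0 : Algebra.norm k[X] (0 : W.CoordinateRing) = 0 := by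
      simpa using norm_smul_basis (W' := W) 0 0
    rwa [Finset.sum_empty, h0, degree_zero]
  | insert i s hi ih =>
    rw [Finset.sum_insert hi]
    exact (degree_norm_add_le W _ _).trans_lt (max_lt (h i (Finset.mem_insert_self i s))
      (ih fun j hj => h j (Finset.mem_insert_of_mem hj)))

lemma degree_norm_mk_C_X : (Algebra.norm k[X] (mk W (C X))).degree = 2 := by
  have e : mk W (C X) = (X : k[X]) • (1 : W.CoordinateRing) + (0 : k[X]) • mk W X := by
    rw [zero_smul, add_zero, smul, mul_one]
  rw [e, degree_norm_smul_basis]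
  simp

lemma degree_norm_mk_X : (Algebra.norm k[X] (mk W X)).degree = 3 := by
  have e : mk W X = (0 : k[X]) • (1 : W.CoordinateRing) + (1 : k[X]) • mk W X := by
    rw [zero_smul, zero_add, one_smul]
  rw [e, degree_norm_smul_basis]
  simp

lemma degree_norm_algebraMap {c : k} (hc : c ≠ 0) :
    (Algebra.norm k[X] (algebraMap k W.CoordinateRing c)).degree = 0 := by
  have e : algebraMap k W.CoordinateRing c =
      (C c : k[X]) • (1 : W.CoordinateRing) + (0 : k[X]) • mk W X := by
    rw [zero_smul, add_zero, smul, mul_one, mk_C_C]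
  rw [e, degree_norm_smul_basis, degree_C hc]
  simp

lemma degree_norm_monomial {c : k} (hc : c ≠ 0) (m : Fin 3 →₀ ℕ) :
    (Algebra.norm k[X] (formClass W (MvPolynomial.monomial m c))).degree =
      ((2 * m 0 + 3 * m 1 : ℕ) : WithBot ℕ) := by
  have e : formClass W (MvPolynomial.monomial m c) =
      algebraMap k W.CoordinateRing c * (mk W (C X) ^ m 0 * mk W X ^ m 1) := by
    simp [formClass, MvPolynomial.eval₂_monomial, Finsupp.prod_fintype, Fin.prod_univ_succ]
  rw [e, map_mul, map_mul, map_pow, map_pow, degree_mul, degree_mul, degree_pow, degree_pow,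
    degree_norm_algebraMap W hc, degree_norm_mk_C_X, degree_norm_mk_X, zero_add]
  push_cast
  simp only [nsmul_eq_mul]
  ring

lemma eval_infinity {A : MvPolynomial (Fin 3) k} {d : ℕ} (hA : A.IsHomogeneous d) (c : k) :
    MvPolynomial.eval ![0, c, 0] A = A.coeff (Finsupp.single 1 d) * c ^ d := by
  rw [MvPolynomial.eval_eq', Finset.sum_eq_single (Finsupp.single 1 d)]
  · simp [Fin.prod_univ_succ]
  · intro m hm hne
    have hdeg : m.degree = d := by
      by_contra h
      exact MvPolynomial.mem_support_iff.1 hm (hA.coeff_eq_zero h)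
    rw [Finsupp.degree_eq_sum, Fin.sum_univ_three] at hdeg
    have : m 0 ≠ 0 ∨ m 2 ≠ 0 := by
      by_contra! h
      refine hne (Finsupp.ext fun i => ?_)
      fin_cases i
      · simpa using h.1
      · simpa [h.1, h.2] using hdeg
      · simpa using h.2
    rcases this with h | h <;> simp [Fin.prod_univ_succ, h]
  · intro h
    rw [MvPolynomial.notMem_support_iff.1 h, zero_mul]

/-- Among the monomials of degree d, only Yᵈ has a norm of degree 3d; every other one has smaller
degree 2m₀ + 3m₁. A form that is zero on the curve hence has no Yᵈ term, and that coefficient is its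
value at [0 : 1 : 0]. -/
lemma eval_infinity_eq_zero {A : MvPolynomial (Fin 3) k} {d : ℕ} (hA : A.IsHomogeneous d)
    (h : formClass W A = 0) : MvPolynomial.eval ![0, 1, 0] A = 0 := by
  classical
  rw [eval_infinity hA, one_pow, mul_one]
  by_contra hc
  have hmem : Finsupp.single 1 d ∈ A.support := MvPolynomial.mem_support_iff.2 hc
  have h1 : formClass W (MvPolynomial.monomial (Finsupp.single 1 d) (A.coeff (Finsupp.single 1 d))) =
      -∑ m ∈ A.support.erase (Finsupp.single 1 d),
        formClass W (MvPolynomial.monomial m (A.coeff m)) := by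
    rw [eq_neg_iff_add_eq_zero, Finset.add_sum_erase A.support
      (fun m => formClass W (MvPolynomial.monomial m (A.coeff m))) hmem, ← map_sum,
      MvPolynomial.support_sum_monomial_coeff, h]
  have h2 := degree_norm_sum_lt W (A.support.erase (Finsupp.single 1 d))
    (fun m => -formClass W (MvPolynomial.monomial m (A.coeff m))) (n := ((3 * d : ℕ) : WithBot ℕ))
    (WithBot.bot_lt_coe _) fun m hm => by
      obtain ⟨hne, hm⟩ := Finset.mem_erase.1 hm
      have hm' := MvPolynomial.mem_support_iff.1 hm
      have hdeg : m.degree = d := by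
        by_contra h
        exact hm' (hA.coeff_eq_zero h)
      rw [Finsupp.degree_eq_sum, Fin.sum_univ_three] at hdeg
      rw [← map_neg, ← map_neg, degree_norm_monomial W (neg_ne_zero.2 hm')]
      refine WithBot.coe_lt_coe.2 ?_
      have : m 1 ≠ d := by
        intro h1
        refine hne (Finsupp.ext fun i => ?_)
        fin_cases i <;> simp <;> omega
      change 2 * m 0 + 3 * m 1 < 3 * d
      omega
  rw [Finset.sum_neg_distrib, ← h1, degree_norm_monomial W hc] at h2
  simp at h2

end Infinity

variable {W}

/-- Evaluation at a point is well defined on the curve. Consequently a denominator that does not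
vanish at P is automatically nonzero in the function field. -/
lemma eval_coords_eq_zero {A : MvPolynomial (Fin 3) k} {d : ℕ} (hA : A.IsHomogeneous d)
    (P : W.Point) (h : formVal W A = 0) : MvPolynomial.eval (coords P) A = 0 := by
  have h0 : formClass W A = 0 := by
    rw [← algebraMap_formClass] at h
    exact (IsFractionRing.injective W.CoordinateRing W.FunctionField) (by rw [h, map_zero])
  rcases P with _ | ⟨x, y, hP⟩
  · exact eval_infinity_eq_zero W hA h0
  · have := evalAt_formClass hP.1 A
    rw [h0, map_zero] at this
    exact this.symm

end EllDegree

/-! ### Local rings in affine charts -/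

namespace EllDegree

open WeierstrassCurve

variable {k : Type*} [Field k] {W : Affine k}

/-- The index of a homogeneous coordinate that is `1` at the point. -/
def chart : W.Point → Fin 3
  | .zero => 1
  | .some _ _ _ => 2

lemma coords_chart (P : W.Point) : coords P (chart P) = 1 := by
  cases P <;> rfl

lemma formVal_X (j : Fin 3) : formVal W (MvPolynomial.X j) = genericCoords W j := by
  simp [formVal]

lemma formVal_ne_zero {A : MvPolynomial (Fin 3) k} {d : ℕ} (hA : A.IsHomogeneous d) {P : W.Point}
    (h : MvPolynomial.eval (coords P) A ≠ 0) : formVal W A ≠ 0 := fun h0 =>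
  h (eval_coords_eq_zero hA P h0)

lemma genericCoords_chart_ne_zero (P : W.Point) : genericCoords W (chart P) ≠ 0 := by
  rw [← formVal_X]
  refine formVal_ne_zero (MvPolynomial.isHomogeneous_X _ _) (P := P) ?_
  rw [MvPolynomial.eval_X, coords_chart]
  exact one_ne_zero

/-- The coordinate functions of an affine chart around the point. -/
noncomputable def localCoord (P : W.Point) (j : Fin 3) : W.FunctionField :=
  genericCoords W j / genericCoords W (chart P)

/-- The value of a polynomial in the coordinate functions of an affine chart around the point. -/
noncomputable def localVal (P : W.Point) : MvPolynomial (Fin 3) k →+* W.FunctionField :=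
  MvPolynomial.eval₂Hom (algebraMap k W.FunctionField) (localCoord P)

@[simp] lemma localVal_X (P : W.Point) (j : Fin 3) :
    localVal P (MvPolynomial.X j) = localCoord P j := by
  simp [localVal]

@[simp] lemma localVal_C (P : W.Point) (c : k) :
    localVal P (MvPolynomial.C c) = algebraMap k W.FunctionField c := by
  simp [localVal]

lemma formVal_eq_localVal (P : W.Point) {A : MvPolynomial (Fin 3) k} {d : ℕ}
    (hA : A.IsHomogeneous d) :
    formVal W A = genericCoords W (chart P) ^ d * localVal P A := by
  simp only [formVal, localVal, MvPolynomial.coe_eval₂Hom, MvPolynomial.eval₂_eq', Finset.mul_sum]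
  refine Finset.sum_congr rfl fun m hm => ?_
  have hdeg : m.degree = d := by
    by_contra h
    exact MvPolynomial.mem_support_iff.1 hm (hA.coeff_eq_zero h)
  have h0 := genericCoords_chart_ne_zero P
  rw [mul_left_comm, ← hdeg, Finsupp.degree_eq_sum, ← Finset.prod_pow_eq_pow_sum,
    ← Finset.prod_mul_distrib]
  refine congrArg _ (Finset.prod_congr rfl fun j _ => ?_)
  rw [localCoord, ← mul_pow, mul_div_cancel₀ _ h0]

/-- Homogenisation: degrees are padded with powers of the chart coordinate, which is 1 both as a
local coordinate and at P. -/
lemma exists_form (P : W.Point) (a : MvPolynomial (Fin 3) k) :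
    ∃ (d : ℕ) (A : MvPolynomial (Fin 3) k), A.IsHomogeneous d ∧ localVal P A = localVal P a ∧
      MvPolynomial.eval (coords P) A = MvPolynomial.eval (coords P) a := by
  have hch : localCoord P (chart P) = 1 := div_self (genericCoords_chart_ne_zero P)
  induction a using MvPolynomial.induction_on with
  | C c => exact ⟨0, _, MvPolynomial.isHomogeneous_C _ c, rfl, rfl⟩
  | add a b ha hb =>
    obtain ⟨d, A, hA, hA1, hA2⟩ := ha
    obtain ⟨e, B, hB, hB1, hB2⟩ := hb
    refine ⟨d + e, A * MvPolynomial.X (chart P) ^ e + MvPolynomial.X (chart P) ^ d * B,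
      (hA.mul (MvPolynomial.isHomogeneous_X_pow _ _)).add
        ((MvPolynomial.isHomogeneous_X_pow _ _).mul hB), ?_, ?_⟩
    · simp [hA1, hB1, hch]
    · simp [hA2, hB2, coords_chart]
  | mul_X a j ha =>
    obtain ⟨d, A, hA, hA1, hA2⟩ := ha
    exact ⟨d + 1, A * MvPolynomial.X j, hA.mul (MvPolynomial.isHomogeneous_X _ _),
      by simp [hA1], by simp [hA2]⟩

lemma localVal_ne_zero {P : W.Point} {a : MvPolynomial (Fin 3) k}
    (h : MvPolynomial.eval (coords P) a ≠ 0) : localVal P a ≠ 0 := by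
  obtain ⟨d, A, hA, hA1, hA2⟩ := exists_form P a
  rw [← hA1]
  exact right_ne_zero_of_mul (formVal_eq_localVal P hA ▸ formVal_ne_zero hA (hA2 ▸ h))

lemma mem_localRing_iff {P : W.Point} {f : W.FunctionField} : f ∈ localRing W P ↔
    ∃ a b : MvPolynomial (Fin 3) k, MvPolynomial.eval (coords P) b ≠ 0 ∧
      f = localVal P a / localVal P b := by
  have h0 := genericCoords_chart_ne_zero P
  constructor
  · rintro ⟨d, A, B, hA, hB, hBP, -, rfl⟩
    exact ⟨A, B, hBP, by
      rw [formVal_eq_localVal P hA, formVal_eq_localVal P hB,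
        mul_div_mul_left _ _ (pow_ne_zero d h0)]⟩
  · rintro ⟨a, b, hb, rfl⟩
    obtain ⟨d, A, hA, hA1, -⟩ := exists_form P a
    obtain ⟨e, B, hB, hB1, hB2⟩ := exists_form P b
    have hX : ∀ n, (MvPolynomial.X (chart P) ^ n : MvPolynomial (Fin 3) k).IsHomogeneous n :=
      fun n => MvPolynomial.isHomogeneous_X_pow _ _
    have hBe : MvPolynomial.eval (coords P) (MvPolynomial.X (chart P) ^ d * B) ≠ 0 := by
      simpa [coords_chart, hB2] using hb
    refine ⟨d + e, A * MvPolynomial.X (chart P) ^ e, MvPolynomial.X (chart P) ^ d * B,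
      hA.mul (hX e), (hX d).mul hB, hBe, formVal_ne_zero ((hX d).mul hB) hBe, ?_⟩
    have hch : localCoord P (chart P) = 1 := div_self h0
    rw [formVal_eq_localVal P (hA.mul (hX e)), formVal_eq_localVal P ((hX d).mul hB),
        mul_div_mul_left _ _ (pow_ne_zero _ h0)]
    simp [hch, hA1, hB1]

lemma localVal_mem (P : W.Point) (a : MvPolynomial (Fin 3) k) : localVal P a ∈ localRing W P :=
  mem_localRing_iff.2 ⟨a, 1, by simp, by simp⟩

lemma inv_localVal_mem {P : W.Point} {a : MvPolynomial (Fin 3) k}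
    (h : MvPolynomial.eval (coords P) a ≠ 0) : (localVal P a)⁻¹ ∈ localRing W P :=
  mem_localRing_iff.2 ⟨1, a, h, by simp⟩

/-- As in a localisation, each element is a unit times the image of a polynomial, so every ideal is
extended from the Noetherian polynomial ring. -/
lemma isNoetherianRing_localRing (P : W.Point) : IsNoetherianRing (localRing W P) := by
  let φ : MvPolynomial (Fin 3) k →+* localRing W P := (localVal P).codRestrict _ (localVal_mem P)
  refine isNoetherianRing_iff_ideal_fg _ |>.2 fun I => ?_
  have h : I = (I.comap φ).map φ := by
    refine le_antisymm (fun f hf => ?_) Ideal.map_comap_le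
    obtain ⟨a, b, hb, hfab⟩ := mem_localRing_iff.1 f.2
    have hb0 := localVal_ne_zero hb
    have h1 : φ a = φ b * f := Subtype.ext (by
      change localVal P a = localVal P b * f.1
      rw [hfab, mul_div_cancel₀ _ hb0])
    have h2 : f = ⟨_, inv_localVal_mem hb⟩ * φ a := Subtype.ext (by
      change f.1 = (localVal P b)⁻¹ * localVal P a
      rw [hfab, div_eq_inv_mul])
    rw [h2]
    refine Ideal.mul_mem_left _ _ (Ideal.mem_map_of_mem φ ?_)
    rw [Ideal.mem_comap, h1]
    exact I.mul_mem_left _ hf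
  rw [h]
  exact ((isNoetherianRing_iff_ideal_fg _).1 inferInstance (I.comap φ)).map φ

lemma formClass_surjective : Function.Surjective (formClass W) := fun r => by
  obtain ⟨p, q, rfl⟩ := Affine.CoordinateRing.exists_smul_basis_eq r
  have h : ∀ p : Polynomial k, formClass W (Polynomial.aeval (MvPolynomial.X 0) p) =
      Affine.CoordinateRing.mk W (Polynomial.C p) := by
    intro p
    suffices h : ((formClass W).comp
        (Polynomial.aeval (R := k) (MvPolynomial.X (R := k) (0 : Fin 3))).toRingHom) =
        (Affine.CoordinateRing.mk W).comp Polynomial.C from RingHom.congr_fun h p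
    refine Polynomial.ringHom_ext (fun c => ?_) ?_
    · simp [formClass, ← mk_C_C, MvPolynomial.algebraMap_eq]
    · simp [formClass]
  refine ⟨Polynomial.aeval (MvPolynomial.X 0) p +
    Polynomial.aeval (MvPolynomial.X 0) q * MvPolynomial.X 1, ?_⟩
  rw [map_add, map_mul, h, h, Affine.CoordinateRing.smul, Affine.CoordinateRing.smul, mul_one]
  simp [formClass]

/-- Each generic coordinate is the quotient of two local ones, with the third in the denominator.
This makes every rational function a quotient of elements of the local ring. -/
lemma exists_formVal_eq_div (P : W.Point) (A : MvPolynomial (Fin 3) k) :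
    ∃ a b : MvPolynomial (Fin 3) k, localVal P b ≠ 0 ∧
      formVal W A = localVal P a / localVal P b := by
  have h2 : localVal P (MvPolynomial.X 2) ≠ 0 := by
    rw [localVal_X]
    exact div_ne_zero (by simp [genericCoords]) (genericCoords_chart_ne_zero P)
  induction A using MvPolynomial.induction_on with
  | C c => exact ⟨MvPolynomial.C c, 1, by simp, by simp [formVal]⟩
  | add A B hA hB =>
    obtain ⟨a, b, hb, hab⟩ := hA
    obtain ⟨c, d, hd, hcd⟩ := hB
    exact ⟨a * d + b * c, b * d, by simp [hb, hd], by
      rw [map_add, hab, hcd, div_add_div _ _ hb hd, map_add, map_mul, map_mul, map_mul]⟩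
  | mul_X a j ha =>
    obtain ⟨a, b, hb, hab⟩ := ha
    refine ⟨a * MvPolynomial.X j, b * MvPolynomial.X 2, by rw [map_mul]; exact mul_ne_zero hb h2, ?_⟩
    rw [map_mul, hab, map_mul, map_mul, mul_div_mul_comm, formVal_X, localVal_X, localVal_X,
      localCoord, localCoord, div_div_div_cancel_right₀ (genericCoords_chart_ne_zero P)]
    simp [genericCoords]

lemma exists_eq_formVal_div (f : W.FunctionField) :
    ∃ A B : MvPolynomial (Fin 3) k, formVal W B ≠ 0 ∧ f = formVal W A / formVal W B := by
  obtain ⟨r, s, hs, rfl⟩ := IsFractionRing.div_surjective (A := W.CoordinateRing) f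
  obtain ⟨A, rfl⟩ := formClass_surjective r
  obtain ⟨B, rfl⟩ := formClass_surjective s
  refine ⟨A, B, ?_, by rw [algebraMap_formClass, algebraMap_formClass]⟩
  rw [← algebraMap_formClass]
  exact IsFractionRing.to_map_ne_zero_of_mem_nonZeroDivisors hs

/-- A local coordinate that divides the others generates the maximal ideal of the local ring. -/
lemma isUniformizer_of_div_mem {P : W.Point} {j : Fin 3}
    (hj : localCoord P j ≠ algebraMap k W.FunctionField (coords P j))
    (h : ∀ l, (localCoord P l - algebraMap k W.FunctionField (coords P l)) /
      (localCoord P j - algebraMap k W.FunctionField (coords P j)) ∈ localRing W P) :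
    (localRing W P).IsUniformizer k
      (localCoord P j - algebraMap k W.FunctionField (coords P j)) := by
  set t := localCoord P j - algebraMap k W.FunctionField (coords P j) with ht
  have ht0 : t ≠ 0 := sub_ne_zero.2 hj
  have htv : t = localVal P (MvPolynomial.X j - MvPolynomial.C (coords P j)) := by simp [ht]
  have hC : ∀ c : k, algebraMap k W.FunctionField c ∈ localRing W P := fun c => by
    rw [← localVal_C P]
    exact localVal_mem P _
  -- Divisibility by t passes from the centred coordinates to every polynomial minus its value at P,
  -- by the product rule for differences.
  have key : ∀ a : MvPolynomial (Fin 3) k, (localVal P a -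
      algebraMap k W.FunctionField (MvPolynomial.eval (coords P) a)) / t ∈ localRing W P := by
    intro a
    induction a using MvPolynomial.induction_on with
    | C c => simp [zero_mem]
    | add a b ha hb =>
      convert! add_mem ha hb using 1
      simp only [map_add]
      ring
    | mul_X a l ha =>
      convert! add_mem (mul_mem (localVal_mem P (MvPolynomial.X l)) ha)
        (mul_mem (hC (MvPolynomial.eval (coords P) a)) (h l)) using 1
      simp only [map_mul, MvPolynomial.eval_X, localVal_X]
      ring
  refine ⟨htv ▸ localVal_mem P _, ht0, fun hmem => ?_, hC, fun f hf => ?_, fun f hf => ?_,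
    isNoetherianRing_localRing P, fun f => ?_⟩
  · obtain ⟨a, b, hb, hab⟩ := mem_localRing_iff.1 hmem
    have hb0 := localVal_ne_zero hb
    -- If t⁻¹ = a/b, then ta - b is zero on the curve, although its value at P is -b(P) ≠ 0.
    have h1 : localVal P ((MvPolynomial.X j - MvPolynomial.C (coords P j)) * a - b) = 0 := by
      rw [eq_div_iff hb0, inv_mul_eq_iff_eq_mul₀ ht0] at hab
      rw [map_sub, map_mul, ← htv, hab, sub_self]
    refine localVal_ne_zero (P := P) ?_ h1
    simpa using hb
  · obtain ⟨a, b, hb, rfl⟩ := mem_localRing_iff.1 hf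
    by_cases ha : MvPolynomial.eval (coords P) a = 0
    · right
      have := mul_mem (key a) (inv_localVal_mem hb)
      rw [ha, map_zero, sub_zero] at this
      convert! this using 1
      ring
    · left
      rw [inv_div]
      exact mem_localRing_iff.2 ⟨b, a, ha, rfl⟩
  · obtain ⟨a, b, hb, rfl⟩ := mem_localRing_iff.1 hf
    refine ⟨MvPolynomial.eval (coords P) a / MvPolynomial.eval (coords P) b, ?_⟩
    -- The residue of a/b is c = a(P)/b(P), since a - cb vanishes at P.
    have h1 := key (a - MvPolynomial.C
      (MvPolynomial.eval (coords P) a / MvPolynomial.eval (coords P) b) * b)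
    have h2 := mul_mem h1 (inv_localVal_mem hb)
    have hb0 := localVal_ne_zero hb
    rw [map_sub (MvPolynomial.eval (coords P)), map_mul (MvPolynomial.eval (coords P)),
      MvPolynomial.eval_C, div_mul_cancel₀ _ hb, sub_self, map_zero, sub_zero, map_sub, map_mul,
      localVal_C] at h2
    convert! h2 using 1
    field_simp
  · obtain ⟨A, B, hB, rfl⟩ := exists_eq_formVal_div f
    obtain ⟨a, b, hb, hab⟩ := exists_formVal_eq_div P A
    obtain ⟨c, d, hd, hcd⟩ := exists_formVal_eq_div P B
    have hc : localVal P c ≠ 0 := fun h0 => hB (by rw [hcd, h0, zero_div])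
    refine ⟨localVal P (a * d), localVal_mem P _, localVal P (b * c), localVal_mem P _, ?_, ?_⟩
    · rw [map_mul]
      exact mul_ne_zero hb hc
    · rw [hab, hcd, div_div_div_eq, map_mul, map_mul]

end EllDegree

/-! ### Uniformizers and orders of the coordinate functions -/

namespace EllDegree

open WeierstrassCurve

variable {k : Type*} [Field k] {W : Affine k}

lemma localCoord_some {x₀ y₀ : k} (h : W.Nonsingular x₀ y₀) (j : Fin 3) :
    localCoord (.some x₀ y₀ h) j = ![xCoord W, yCoord W, 1] j := by
  rw [localCoord, genericCoords_eq]
  exact div_one _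

lemma xCoord_sub_ne_zero (c : k) : xCoord W - algebraMap k W.FunctionField c ≠ 0 := by
  have h0 := Affine.CoordinateRing.XClass_ne_zero (W' := W) c
  rw [algebraMap_field_apply, xCoord, ← map_sub]
  refine (map_ne_zero_iff _ (IsFractionRing.injective W.CoordinateRing W.FunctionField)).2 ?_
  rwa [Affine.CoordinateRing.XClass, map_sub, map_sub] at h0

lemma yCoord_sub_ne_zero (c : k) : yCoord W - algebraMap k W.FunctionField c ≠ 0 := by
  have h0 := Affine.CoordinateRing.YClass_ne_zero (W' := W) (Polynomial.C c)
  rw [algebraMap_field_apply, yCoord, ← map_sub]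
  refine (map_ne_zero_iff _ (IsFractionRing.injective W.CoordinateRing W.FunctionField)).2 ?_
  rwa [Affine.CoordinateRing.YClass, map_sub] at h0

/-- The cofactor of `x - x₀` in the equation of the curve centred at `(x₀, y₀)`. -/
noncomputable def xCofactor (W : Affine k) (x₀ : k) : MvPolynomial (Fin 3) k :=
  .X 0 ^ 2 + .C x₀ * .X 0 + .C (x₀ ^ 2) + .C W.a₂ * (.X 0 + .C x₀) + .C W.a₄ - .C W.a₁ * .X 1

/-- The cofactor of `y - y₀` in the equation of the curve centred at `(x₀, y₀)`. -/
noncomputable def yCofactor (W : Affine k) (x₀ y₀ : k) : MvPolynomial (Fin 3) k :=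
  .X 1 + .C (y₀ + W.a₃ + W.a₁ * x₀)

/-- Subtract the equation at (x₀, y₀) from that at the generic point and collect the factors x - x₀
and y - y₀. At the point the cofactors are partial derivatives up to sign, so by nonsingularity one
of them is a local unit. -/
lemma mul_xCofactor {x₀ y₀ : k} (h : W.Nonsingular x₀ y₀) :
    (xCoord W - algebraMap k _ x₀) * localVal (.some x₀ y₀ h) (xCofactor W x₀) =
      (yCoord W - algebraMap k _ y₀) * localVal (.some x₀ y₀ h) (yCofactor W x₀ y₀) := by
  have h1 := congrArg (algebraMap k W.FunctionField) ((Affine.equation_iff ..).1 h.1)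
  have h2 := coord_equation W
  simp only [xCofactor, yCofactor, map_add, map_sub, map_mul, map_pow, localVal_X, localVal_C,
    localCoord_some, Matrix.cons_val_zero, Matrix.cons_val_one] at *
  linear_combination h1 - h2

lemma eval_xCofactor {x₀ y₀ : k} (h : W.Nonsingular x₀ y₀) :
    MvPolynomial.eval (coords (.some x₀ y₀ h)) (xCofactor W x₀) =
      -(W.a₁ * y₀ - (3 * x₀ ^ 2 + 2 * W.a₂ * x₀ + W.a₄)) := by
  simp [xCofactor, coords]
  ring

lemma eval_yCofactor {x₀ y₀ : k} (h : W.Nonsingular x₀ y₀) :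
    MvPolynomial.eval (coords (.some x₀ y₀ h)) (yCofactor W x₀ y₀) = y₀ - W.negY x₀ y₀ := by
  simp [yCofactor, coords, Affine.negY]
  ring

lemma isUniformizer_xCoord_sub {x₀ y₀ : k} (h : W.Nonsingular x₀ y₀) (hy : y₀ ≠ W.negY x₀ y₀) :
    (localRing W (.some x₀ y₀ h)).IsUniformizer k (xCoord W - algebraMap k _ x₀) := by
  have hx0 := xCoord_sub_ne_zero (W := W) x₀
  have hu : MvPolynomial.eval (coords (.some x₀ y₀ h)) (yCofactor W x₀ y₀) ≠ 0 := by
    rw [eval_yCofactor]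
    exact sub_ne_zero.2 hy
  have hu0 := localVal_ne_zero hu
  have := isUniformizer_of_div_mem (P := .some x₀ y₀ h) (j := 0)
    (by simpa [localCoord_some, coords] using sub_ne_zero.1 hx0) fun l => by
      fin_cases l
      · simp [localCoord_some, coords, div_self hx0, one_mem]
      · have e : (yCoord W - algebraMap k _ y₀) / (xCoord W - algebraMap k _ x₀) =
            localVal (.some x₀ y₀ h) (xCofactor W x₀) *
              (localVal (.some x₀ y₀ h) (yCofactor W x₀ y₀))⁻¹ := by
          rw [← div_eq_mul_inv, div_eq_div_iff hx0 hu0, ← mul_xCofactor, mul_comm]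
        simpa [localCoord_some, coords, e] using
          mul_mem (localVal_mem (.some x₀ y₀ h) (xCofactor W x₀)) (inv_localVal_mem hu)
      · simp [localCoord_some, coords, zero_mem]
  simpa [localCoord_some, coords] using this

/-- At a point with P = -P the cofactor of y - y₀ is y - y₀ itself, and the other cofactor must be a
unit. Thus x - x₀ vanishes doubly. -/
lemma xCoord_sub_eq {x₀ y₀ : k} (h : W.Nonsingular x₀ y₀) (hy : y₀ = W.negY x₀ y₀) :
    MvPolynomial.eval (coords (.some x₀ y₀ h)) (xCofactor W x₀) ≠ 0 ∧
      xCoord W - algebraMap k _ x₀ = (yCoord W - algebraMap k _ y₀) ^ 2 *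
        (localVal (.some x₀ y₀ h) (xCofactor W x₀))⁻¹ := by
  have hw : MvPolynomial.eval (coords (.some x₀ y₀ h)) (xCofactor W x₀) ≠ 0 := by
    rw [eval_xCofactor]
    refine neg_ne_zero.2 (((Affine.nonsingular_iff' ..).1 h).2.resolve_right fun h' => h' ?_)
    rw [Affine.negY] at hy
    linear_combination hy
  refine ⟨hw, ?_⟩
  rw [eq_mul_inv_iff_mul_eq₀ (localVal_ne_zero hw), mul_xCofactor]
  have := congrArg (algebraMap k W.FunctionField) hy
  simp only [yCofactor, Affine.negY, map_add, map_sub, map_mul, map_neg, localVal_X, localVal_C,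
    localCoord_some, Matrix.cons_val_one, Matrix.cons_val_zero] at *
  linear_combination (yCoord W - algebraMap k _ y₀) * this

lemma isUniformizer_yCoord_sub {x₀ y₀ : k} (h : W.Nonsingular x₀ y₀) (hy : y₀ = W.negY x₀ y₀) :
    (localRing W (.some x₀ y₀ h)).IsUniformizer k (yCoord W - algebraMap k _ y₀) := by
  have hy0 := yCoord_sub_ne_zero (W := W) y₀
  obtain ⟨hw, hX⟩ := xCoord_sub_eq h hy
  have := isUniformizer_of_div_mem (P := .some x₀ y₀ h) (j := 1)
    (by simpa [localCoord_some, coords] using sub_ne_zero.1 hy0) fun l => by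
      fin_cases l
      · have e : (xCoord W - algebraMap k _ x₀) / (yCoord W - algebraMap k _ y₀) =
            localVal (.some x₀ y₀ h) (.X 1 - .C y₀) *
              (localVal (.some x₀ y₀ h) (xCofactor W x₀))⁻¹ := by
          rw [hX, div_eq_iff hy0]
          simp [localCoord_some]
          ring
        simpa only [localCoord_some, coords, e, Fin.zero_eta, Fin.mk_one, Matrix.cons_val_zero,
          Matrix.cons_val_one] using
          mul_mem (localVal_mem (.some x₀ y₀ h) (.X 1 - .C y₀)) (inv_localVal_mem hw)
      · simp [localCoord_some, coords, div_self hy0, one_mem]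
      · simp [localCoord_some, coords, zero_mem]
  simpa [localCoord_some, coords] using this

lemma yCoord_ne_zero : yCoord W ≠ 0 := by
  simpa using yCoord_sub_ne_zero (W := W) 0

lemma xCoord_ne_zero : xCoord W ≠ 0 := by
  simpa using xCoord_sub_ne_zero (W := W) 0

lemma localCoord_zero (j : Fin 3) :
    localCoord (.zero : W.Point) j = ![xCoord W / yCoord W, 1, 1 / yCoord W] j := by
  have : localCoord (.zero : W.Point) j = ![xCoord W, yCoord W, 1] j / yCoord W := rfl
  rw [this]
  fin_cases j <;> simp [div_self (yCoord_ne_zero (W := W))]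

/-- The cofactor of `1 / y` in the equation of the curve centred at the point at infinity. -/
noncomputable def infinityCofactor (W : Affine k) : MvPolynomial (Fin 3) k :=
  1 + .C W.a₁ * .X 0 + .C W.a₃ * .X 2 - .C W.a₂ * .X 0 ^ 2 - .C W.a₄ * .X 0 * .X 2 -
    .C W.a₆ * .X 2 ^ 2

lemma eval_infinityCofactor :
    MvPolynomial.eval (coords (.zero : W.Point)) (infinityCofactor W) ≠ 0 := by
  simp [infinityCofactor, coords]

/-- The Weierstrass equation divided by y³, in the coordinates x/y and 1/y. The cofactor is 1 at
infinity, which gives x and y poles of orders 2 and 3. -/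
lemma inv_yCoord_eq : (yCoord W)⁻¹ = (xCoord W / yCoord W) ^ 3 *
    (localVal (.zero : W.Point) (infinityCofactor W))⁻¹ := by
  have hy := yCoord_ne_zero (W := W)
  rw [eq_mul_inv_iff_mul_eq₀ (localVal_ne_zero eval_infinityCofactor)]
  simp only [infinityCofactor, map_add, map_sub, map_mul, map_pow, map_one, localVal_X, localVal_C,
    localCoord_zero, Matrix.cons_val_zero, Matrix.cons_val]
  field_simp
  linear_combination coord_equation W

lemma isUniformizer_infinity :
    (localRing W .zero).IsUniformizer k (xCoord W / yCoord W) := by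
  have h0 : xCoord W / yCoord W ≠ 0 := div_ne_zero xCoord_ne_zero yCoord_ne_zero
  have := isUniformizer_of_div_mem (P := (.zero : W.Point)) (j := 0)
    (by simpa [localCoord_zero, coords] using ⟨xCoord_ne_zero, yCoord_ne_zero⟩) fun l => by
      fin_cases l
      · simp [localCoord_zero, coords, div_self h0, one_mem]
      · simp [localCoord_zero, coords, zero_mem]
      · have e : (yCoord W)⁻¹ / (xCoord W / yCoord W) = localVal (.zero : W.Point) (.X 0 ^ 2) *
              (localVal (.zero : W.Point) (infinityCofactor W))⁻¹ := by
          rw [inv_yCoord_eq, div_eq_iff h0]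
          simp only [map_pow, localVal_X, localCoord_zero, Matrix.cons_val_zero]
          ring
        have := mul_mem (localVal_mem (.zero : W.Point) (.X 0 ^ 2))
          (inv_localVal_mem (eval_infinityCofactor (W := W)))
        rw [← e] at this
        simpa [localCoord_zero, coords] using this
  simpa [localCoord_zero, coords] using this

lemma exists_isUniformizer (P : W.Point) : ∃ t, (localRing W P).IsUniformizer k t := by
  rcases P with _ | ⟨x₀, y₀, h⟩
  · exact ⟨_, isUniformizer_infinity⟩
  · by_cases hy : y₀ = W.negY x₀ y₀
    · exact ⟨_, isUniformizer_yCoord_sub h hy⟩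
    · exact ⟨_, isUniformizer_xCoord_sub h hy⟩

/-- A uniformizer at the point. -/
noncomputable def uniformizer (P : W.Point) : W.FunctionField := (exists_isUniformizer P).choose

lemma isUniformizer (P : W.Point) : (localRing W P).IsUniformizer k (uniformizer P) :=
  (exists_isUniformizer P).choose_spec

/-- The order of vanishing of a rational function at a point. -/
noncomputable def ordAt (P : W.Point) (f : W.FunctionField) : ℤ :=
  (localRing W P).order (uniformizer P) f

lemma ordAt_eq {P : W.Point} {t : W.FunctionField} (ht : (localRing W P).IsUniformizer k t)
    (f : W.FunctionField) : ordAt P f = (localRing W P).order t f :=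
  (isUniformizer P).order_congr ht f

lemma ordAt_localVal {P : W.Point} {a : MvPolynomial (Fin 3) k}
    (h : MvPolynomial.eval (coords P) a ≠ 0) : ordAt P (localVal P a) = 0 :=
  (isUniformizer P).order_eq_zero (localVal_mem P a) (inv_localVal_mem h)

lemma ordAt_mul (P : W.Point) {f g : W.FunctionField} (hf : f ≠ 0) (hg : g ≠ 0) :
    ordAt P (f * g) = ordAt P f + ordAt P g :=
  (isUniformizer P).order_mul hf hg

lemma ordAt_inv (P : W.Point) (f : W.FunctionField) : ordAt P f⁻¹ = -ordAt P f := by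
  by_cases hf : f = 0
  · simp [hf, ordAt, Subring.order_zero]
  · have := ordAt_mul P hf (inv_ne_zero hf)
    rw [mul_inv_cancel₀ hf] at this
    have h1 := (isUniformizer P).order_algebraMap 1
    rw [map_one] at h1
    change ordAt P 1 = 0 at h1
    linarith

lemma ordAt_algebraMap (P : W.Point) (c : k) : ordAt P (algebraMap k W.FunctionField c) = 0 :=
  (isUniformizer P).order_algebraMap c

lemma ordAt_nonneg_iff (P : W.Point) {f : W.FunctionField} (hf : f ≠ 0) :
    0 ≤ ordAt P f ↔ f ∈ localRing W P :=
  (isUniformizer P).zero_le_order_iff hf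

lemma ordAt_zero_yCoord : ordAt (.zero : W.Point) (yCoord W) = -3 := by
  have h0 : xCoord W / yCoord W ≠ 0 := div_ne_zero xCoord_ne_zero yCoord_ne_zero
  have h := congrArg (ordAt (.zero : W.Point)) (inv_yCoord_eq (W := W))
  have hv := localVal_ne_zero (eval_infinityCofactor (W := W))
  have h3 : ordAt (.zero : W.Point) ((xCoord W / yCoord W) ^ 3) = 3 := by
    rw [ordAt_eq isUniformizer_infinity]
    exact_mod_cast isUniformizer_infinity.order_zpow 3
  rw [ordAt_inv, ordAt_mul _ (pow_ne_zero 3 h0) (inv_ne_zero hv), ordAt_inv,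
    ordAt_localVal eval_infinityCofactor, h3] at h
  linarith

lemma ordAt_zero_xCoord : ordAt (.zero : W.Point) (xCoord W) = -2 := by
  have h1 : ordAt (.zero : W.Point) (xCoord W / yCoord W) = 1 := by
    rw [ordAt_eq isUniformizer_infinity]
    exact isUniformizer_infinity.order_self
  rw [div_eq_mul_inv, ordAt_mul _ xCoord_ne_zero (inv_ne_zero yCoord_ne_zero), ordAt_inv,
    ordAt_zero_yCoord] at h1
  linarith

lemma ordAt_some_xCoord_sub_of_ne {x₀ y₀ c : k} (h : W.Nonsingular x₀ y₀) (hc : x₀ ≠ c) :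
    ordAt (.some x₀ y₀ h) (xCoord W - algebraMap k _ c) = 0 := by
  have := ordAt_localVal (P := .some x₀ y₀ h) (a := .X 0 - .C c)
    (by simpa [coords] using sub_ne_zero.2 hc)
  simpa [localCoord_some] using this

lemma ordAt_some_xCoord_sub_of_ne_negY {x₀ y₀ : k} (h : W.Nonsingular x₀ y₀)
    (hy : y₀ ≠ W.negY x₀ y₀) : ordAt (.some x₀ y₀ h) (xCoord W - algebraMap k _ x₀) = 1 := by
  rw [ordAt_eq (isUniformizer_xCoord_sub h hy)]
  exact (isUniformizer_xCoord_sub h hy).order_self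

lemma ordAt_some_xCoord_sub_of_eq_negY {x₀ y₀ : k} (h : W.Nonsingular x₀ y₀)
    (hy : y₀ = W.negY x₀ y₀) : ordAt (.some x₀ y₀ h) (xCoord W - algebraMap k _ x₀) = 2 := by
  obtain ⟨hw, hX⟩ := xCoord_sub_eq h hy
  have ht := isUniformizer_yCoord_sub h hy
  have h2 : ordAt (.some x₀ y₀ h) ((yCoord W - algebraMap k _ y₀) ^ 2) = 2 := by
    rw [ordAt_eq ht]
    exact_mod_cast ht.order_zpow 2
  rw [hX, ordAt_mul _ (pow_ne_zero 2 (yCoord_sub_ne_zero y₀)) (inv_ne_zero (localVal_ne_zero hw)),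
    h2, ordAt_inv, ordAt_localVal hw]
  rfl

end EllDegree

/-! ### The involution P ↦ -P -/

namespace EllDegree

open WeierstrassCurve Polynomial

variable {k : Type*} [Field k] (W : Affine k)

/-- The automorphism of the affine coordinate ring induced by the negation of points. -/
noncomputable def negRing : W.CoordinateRing →+* W.CoordinateRing :=
  AdjoinRoot.lift (AdjoinRoot.of W.polynomial) (Affine.CoordinateRing.mk W W.negPolynomial) (by
    have h : Affine.CoordinateRing.mk W (X ^ 2 + C (C W.a₁ * X + C W.a₃) * X -
      C (X ^ 3 + C W.a₂ * X ^ 2 + C W.a₄ * X + C W.a₆)) = 0 := AdjoinRoot.mk_self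
    change eval₂ _ _ (X ^ 2 + C (C W.a₁ * X + C W.a₃) * X -
      C (X ^ 3 + C W.a₂ * X ^ 2 + C W.a₄ * X + C W.a₆)) = 0
    rw [Affine.negPolynomial, eval₂_sub, eval₂_add, eval₂_mul, eval₂_C, eval₂_C,
      eval₂_pow, eval₂_X, ← AdjoinRoot.mk_C, ← AdjoinRoot.mk_C, map_sub (Affine.CoordinateRing.mk W),
      map_neg]
    rw [map_sub, map_add, map_mul, map_pow] at h
    linear_combination h)

lemma negRing_mk_C (p : k[X]) :
    negRing W (Affine.CoordinateRing.mk W (C p)) = Affine.CoordinateRing.mk W (C p) := by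
  rw [negRing, AdjoinRoot.lift_mk, eval₂_C, AdjoinRoot.mk_C]

lemma negRing_mk_X : negRing W (Affine.CoordinateRing.mk W X) =
    -Affine.CoordinateRing.mk W X - Affine.CoordinateRing.mk W (C (C W.a₁ * X + C W.a₃)) := by
  rw [negRing, AdjoinRoot.lift_mk, eval₂_X, Affine.negPolynomial, map_sub, map_neg]

lemma negRing_negRing (r : W.CoordinateRing) : negRing W (negRing W r) = r := by
  obtain ⟨p, q, rfl⟩ := Affine.CoordinateRing.exists_smul_basis_eq r
  simp only [Affine.CoordinateRing.smul, map_add (negRing W), map_mul (negRing W), negRing_mk_C,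
    negRing_mk_X, map_one, map_sub (negRing W), map_neg (negRing W)]
  ring

/-- The coordinate ring is quadratic over k[x] with negation as conjugation, so the norm is the
product with the conjugate. -/
lemma mul_negRing (r : W.CoordinateRing) :
    r * negRing W r = Affine.CoordinateRing.mk W (C (Algebra.norm k[X] r)) := by
  obtain ⟨p, q, rfl⟩ := Affine.CoordinateRing.exists_smul_basis_eq r
  have := Affine.CoordinateRing.coe_norm_smul_basis (W' := W) p q
  rw [AdjoinRoot.mk_C]
  refine Eq.trans ?_ this.symm
  simp only [Affine.CoordinateRing.smul, map_add, map_mul, negRing_mk_C, negRing_mk_X, map_sub,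
    map_neg, mul_one]

lemma negRing_injective : Function.Injective (negRing W) :=
  Function.LeftInverse.injective (negRing_negRing W)

/-- The automorphism of the function field induced by the negation of points. -/
noncomputable def negField : W.FunctionField →+* W.FunctionField :=
  IsFractionRing.map (negRing_injective W)

lemma negField_algebraMap (r : W.CoordinateRing) :
    negField W (algebraMap W.CoordinateRing W.FunctionField r) =
      algebraMap W.CoordinateRing W.FunctionField (negRing W r) := by
  rw [negField, IsFractionRing.map, IsLocalization.map_eq]

lemma negField_const (c : k) :
    negField W (algebraMap k W.FunctionField c) = algebraMap k W.FunctionField c := by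
  rw [algebraMap_field_apply, negField_algebraMap, ← mk_C_C, negRing_mk_C]

lemma negField_xCoord : negField W (xCoord W) = xCoord W := by
  rw [xCoord, negField_algebraMap, negRing_mk_C]

lemma negField_yCoord : negField W (yCoord W) = -yCoord W -
    algebraMap k W.FunctionField W.a₁ * xCoord W - algebraMap k W.FunctionField W.a₃ := by
  simp only [yCoord, xCoord, negField_algebraMap, negRing_mk_X, algebraMap_field_apply, ← mk_C_C,
    map_sub, map_neg, map_add, map_mul]
  ring

lemma negField_negField (f : W.FunctionField) : negField W (negField W f) = f := by
  obtain ⟨r, s, -, rfl⟩ := IsFractionRing.div_surjective (A := W.CoordinateRing) f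
  simp only [map_div₀, negField_algebraMap, negRing_negRing]

variable {W}

/-- The homogeneous coordinates of the negative of the generic point. -/
noncomputable def negCoords (W : Affine k) : Fin 3 → MvPolynomial (Fin 3) k :=
  ![.X 0, -.X 1 - .C W.a₁ * .X 0 - .C W.a₃ * .X 2, .X 2]

/-- The action of the negation of points on forms. -/
noncomputable def negForm (W : Affine k) : MvPolynomial (Fin 3) k →ₐ[k] MvPolynomial (Fin 3) k :=
  MvPolynomial.aeval (negCoords W)

lemma isHomogeneous_negForm {A : MvPolynomial (Fin 3) k} {d : ℕ} (hA : A.IsHomogeneous d) :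
    (negForm W A).IsHomogeneous d := by
  have hX : ∀ i : Fin 3, (MvPolynomial.X i : MvPolynomial (Fin 3) k).IsHomogeneous 1 :=
    MvPolynomial.isHomogeneous_X _
  have h := hA.aeval (negCoords W) (n := 1) fun i => by
    fin_cases i
    · exact hX 0
    · exact ((hX 1).neg.sub ((hX 0).C_mul _)).sub ((hX 2).C_mul _)
    · exact hX 2
  rwa [one_mul] at h

lemma formVal_negForm (A : MvPolynomial (Fin 3) k) :
    formVal W (negForm W A) = negField W (formVal W A) := by
  suffices h : (formVal W).comp (negForm W).toRingHom = (negField W).comp (formVal W) from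
    RingHom.congr_fun h A
  refine MvPolynomial.ringHom_ext (fun c => ?_) fun i => ?_
  · simp [negForm, negCoords, formVal, negField_const, MvPolynomial.algebraMap_eq]
  · fin_cases i
    · simp [negForm, negCoords, formVal, genericCoords_eq, negField_xCoord]
    · simp [negForm, negCoords, formVal, genericCoords_eq, negField_yCoord]
    · simp [negForm, negCoords, formVal, genericCoords_eq]

lemma eval_negForm_ne_zero {P : W.Point} {A : MvPolynomial (Fin 3) k} {d : ℕ}
    (hA : A.IsHomogeneous d) (h : MvPolynomial.eval (coords P) A ≠ 0) :
    MvPolynomial.eval (coords (-P)) (negForm W A) ≠ 0 := by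
  have key : ∀ v : Fin 3 → k, MvPolynomial.eval v (negForm W A) =
      MvPolynomial.eval ![v 0, -v 1 - W.a₁ * v 0 - W.a₃ * v 2, v 2] A := fun v => by
    suffices h : (MvPolynomial.eval v).comp (negForm W).toRingHom =
        MvPolynomial.eval ![v 0, -v 1 - W.a₁ * v 0 - W.a₃ * v 2, v 2] from RingHom.congr_fun h A
    refine MvPolynomial.ringHom_ext (fun c => ?_) fun i => ?_
    · simp [negForm, negCoords, MvPolynomial.algebraMap_eq]
    · fin_cases i <;> simp [negForm, negCoords]
  rw [key]
  rcases P with _ | ⟨x, y, hP⟩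
  · have e : coords (-(.zero : W.Point)) = ![0, 1, 0] := rfl
    rw [e]
    have h' : MvPolynomial.eval ![0, 1, 0] A ≠ 0 := h
    rw [eval_infinity hA] at h'
    -- The formula sends [0 : 1 : 0] to [0 : -1 : 0], the same point; on a form of degree d this
    -- costs only the factor (-1)ᵈ.
    have : (![(![0, 1, 0] : Fin 3 → k) 0, -(![0, 1, 0] : Fin 3 → k) 1 -
        W.a₁ * (![0, 1, 0] : Fin 3 → k) 0 - W.a₃ * (![0, 1, 0] : Fin 3 → k) 2,
        (![0, 1, 0] : Fin 3 → k) 2] : Fin 3 → k) = ![0, -1, 0] := by simp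
    rw [this, eval_infinity hA]
    exact mul_ne_zero (left_ne_zero_of_mul h') (pow_ne_zero d (neg_ne_zero.2 one_ne_zero))
  · have e : coords (-(.some x y hP : W.Point)) = ![x, W.negY x y, 1] := rfl
    rw [e]
    convert! h using 3
    simp only [coords, Affine.negY, Matrix.cons_val_zero, Matrix.cons_val_one, Matrix.cons_val]
    congr 2
    ring

lemma negField_mem_localRing {P : W.Point} {f : W.FunctionField} (hf : f ∈ localRing W P) :
    negField W f ∈ localRing W (-P) := by
  obtain ⟨d, A, B, hA, hB, hBP, -, rfl⟩ := hf
  have h := eval_negForm_ne_zero hB hBP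
  exact ⟨d, negForm W A, negForm W B, isHomogeneous_negForm hA, isHomogeneous_negForm hB, h,
    formVal_ne_zero (isHomogeneous_negForm hB) h, by
      rw [formVal_negForm, formVal_negForm, map_div₀]⟩

lemma ordAt_zpow (P : W.Point) {f : W.FunctionField} (hf : f ≠ 0) (n : ℤ) :
    ordAt P (f ^ n) = n * ordAt P f := by
  have key : ∀ n : ℕ, ordAt P (f ^ n) = n * ordAt P f := by
    intro n
    induction n with
    | zero => simpa using ordAt_algebraMap P 1
    | succ n ih =>
      rw [pow_succ, ordAt_mul P (pow_ne_zero n hf) hf, ih]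
      push_cast
      ring
  rcases le_total 0 n with h | h
  · lift n to ℕ using h
    rw [zpow_natCast, key]
  · obtain ⟨m, rfl⟩ := Int.exists_eq_neg_ofNat h
    rw [zpow_neg, zpow_natCast, ordAt_inv, key]
    ring

lemma ordAt_neg_negField_aux (P : W.Point) {f : W.FunctionField} (hf : f ≠ 0) :
    ordAt (-P) (negField W f) = ordAt P f * ordAt (-P) (negField W (uniformizer P)) := by
  have ht := isUniformizer P
  have ht0 := zpow_ne_zero (ordAt P f) ht.ne_zero
  obtain ⟨h1, h2⟩ := ht.div_zpow_order_mem hf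
  have h3 := (isUniformizer (-P)).order_eq_zero (negField_mem_localRing h1)
    (by rw [← map_inv₀]; exact negField_mem_localRing h2)
  have h4 := ordAt_mul (-P) (f := negField W (f / uniformizer P ^ ordAt P f))
    (g := negField W (uniformizer P ^ ordAt P f)) ((_root_.map_ne_zero _).2 (div_ne_zero hf ht0))
    ((_root_.map_ne_zero _).2 ht0)
  rw [← map_mul, div_mul_cancel₀ _ ht0, map_zpow₀, ordAt_zpow _ ((_root_.map_ne_zero _).2 ht.ne_zero)] at h4
  change ordAt (-P) (negField W (f / uniformizer P ^ ordAt P f)) = 0 at h3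
  rw [h4, h3, zero_add]

/-- Negation multiplies orders by a constant, the order at -P of the image of a uniformizer at P.
The constants for P and -P are nonnegative with product 1, because negation is an involution. -/
lemma ordAt_neg_negField (P : W.Point) (f : W.FunctionField) :
    ordAt (-P) (negField W f) = ordAt P f := by
  by_cases hf : f = 0
  · simp [hf, ordAt, Subring.order_zero]
  have ht := isUniformizer P
  have ht' := isUniformizer (-P)
  have hs0 : negField W (uniformizer (-P)) ≠ 0 := (_root_.map_ne_zero _).2 ht'.ne_zero
  have h1 := ordAt_neg_negField_aux P hs0
  rw [negField_negField] at h1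
  have h2 : ordAt (-P) (uniformizer (-P)) = 1 := ht'.order_self
  have h3 : 0 ≤ ordAt (-P) (negField W (uniformizer P)) :=
    (ordAt_nonneg_iff _ ((_root_.map_ne_zero _).2 ht.ne_zero)).2 (negField_mem_localRing ht.mem)
  have h4 : ordAt (-P) (negField W (uniformizer P)) = 1 := by
    rw [h2] at h1
    exact Int.eq_one_of_mul_eq_one_left h3 h1.symm
  rw [ordAt_neg_negField_aux P hf, h4, mul_one]

end EllDegree

/-! ### Divisors of rational functions and the product formula -/

namespace EllDegree

open WeierstrassCurve Polynomial

variable {k : Type*} [Field k] {W : Affine k}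

lemma min_le_ordAt_add (P : W.Point) {f g : W.FunctionField} (hf : f ≠ 0) (hg : g ≠ 0)
    (hfg : f + g ≠ 0) : min (ordAt P f) (ordAt P g) ≤ ordAt P (f + g) :=
  (isUniformizer P).min_le_order_add hf hg hfg

lemma ordAt_zero_xCoord_sub (c : k) :
    ordAt (.zero : W.Point) (xCoord W - algebraMap k _ c) = -2 := by
  by_cases hc : c = 0
  · rw [hc, map_zero, sub_zero, ordAt_zero_xCoord]
  have hc' : algebraMap k W.FunctionField c ≠ 0 := by simpa using hc
  have hx := xCoord_sub_ne_zero (W := W) c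
  -- The ultrametric inequality is used in both directions: for x = (x - c) + c and for x - c = x +
  -- (-c).
  have h1 := min_le_ordAt_add .zero hx hc' (by simpa using xCoord_ne_zero (W := W))
  have h2 := min_le_ordAt_add (.zero : W.Point) (xCoord_ne_zero (W := W)) (neg_ne_zero.2 hc')
    (by rwa [← sub_eq_add_neg])
  rw [sub_add_cancel, ordAt_algebraMap, ordAt_zero_xCoord] at h1
  rw [← map_neg, ordAt_algebraMap, ordAt_zero_xCoord, map_neg, ← sub_eq_add_neg] at h2
  omega

lemma ordAt_xCoord_sub (P : W.Point) {c y : k} (h : W.Nonsingular c y) :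
    ordAt P (xCoord W - algebraMap k _ c) =
      (Finsupp.single (.some c y h) 1 + Finsupp.single (-.some c y h) 1 -
        Finsupp.single .zero 2 : W.Point →₀ ℤ) P := by
  classical
  rw [Affine.Point.neg_some]
  simp only [Finsupp.sub_apply, Finsupp.add_apply, Finsupp.single_apply]
  rcases P with _ | ⟨x', y', h'⟩
  · simp [ordAt_zero_xCoord_sub]
  · by_cases hx : x' = c
    · subst hx
      by_cases hy : y' = W.negY x' y'
      · rw [ordAt_some_xCoord_sub_of_eq_negY h' hy]
        have : y = y' := by
          rcases Affine.Y_eq_of_X_eq h.1 h'.1 rfl with h0 | h0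
          · exact h0
          · rw [h0, ← hy]
        subst this
        simp [-Affine.negY, ← hy]
      · rw [ordAt_some_xCoord_sub_of_ne_negY h' hy]
        rcases Affine.Y_eq_of_X_eq h.1 h'.1 rfl with h0 | h0
        · subst h0
          simp [-Affine.negY, Ne.symm hy]
        · subst h0
          simp [-Affine.negY, Affine.negY_negY, Ne.symm hy]
    · rw [ordAt_some_xCoord_sub_of_ne h' hx]
      simp [Ne.symm hx]

lemma exists_nonsingular [IsAlgClosed k] [CharZero k] [W.IsElliptic] (c : k) :
    ∃ y, W.Nonsingular c y := by
  obtain ⟨y, hy⟩ := exists_quadratic_eq_zero (K := k) (a := 1) (b := W.a₁ * c + W.a₃)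
    (c := -(c ^ 3 + W.a₂ * c ^ 2 + W.a₄ * c + W.a₆)) one_ne_zero
    (IsAlgClosed.exists_eq_mul_self _)
  refine ⟨y, Affine.equation_iff_nonsingular.1 ((Affine.equation_iff ..).2 ?_)⟩
  linear_combination hy

/-- `D` is the divisor of `f`, and it has degree zero. -/
def HasDivisor (f : W.FunctionField) (D : W.Point →₀ ℤ) : Prop :=
  (∀ P, ordAt P f = D P) ∧ D.degree = 0

lemma hasDivisor_const (c : k) : HasDivisor (algebraMap k W.FunctionField c) 0 :=
  ⟨fun P => by rw [ordAt_algebraMap]; rfl, map_zero _⟩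

lemma HasDivisor.mul {f g : W.FunctionField} {D D' : W.Point →₀ ℤ} (hf : f ≠ 0) (hg : g ≠ 0)
    (h : HasDivisor f D) (h' : HasDivisor g D') : HasDivisor (f * g) (D + D') :=
  ⟨fun P => by rw [ordAt_mul P hf hg, h.1, h'.1]; rfl, by rw [map_add, h.2, h'.2, add_zero]⟩

lemma HasDivisor.inv {f : W.FunctionField} {D : W.Point →₀ ℤ} (h : HasDivisor f D) :
    HasDivisor f⁻¹ (-D) :=
  ⟨fun P => by rw [ordAt_inv, h.1]; rfl, by rw [map_neg, h.2, neg_zero]⟩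

lemma algebraMap_mk_C (p : k[X]) : algebraMap W.CoordinateRing W.FunctionField
    (Affine.CoordinateRing.mk W (C p)) = aeval (xCoord W) p := by
  suffices h : ((algebraMap W.CoordinateRing W.FunctionField).comp
      (Affine.CoordinateRing.mk W)).comp C = (aeval (R := k) (xCoord W)).toRingHom from
    RingHom.congr_fun h p
  refine Polynomial.ringHom_ext (fun c => ?_) ?_
  · have h := algebraMap_field_apply W c
    rw [← mk_C_C] at h
    simpa using h.symm
  · simp [xCoord]

lemma formVal_eq_localVal_some {x y : k} (h : W.Nonsingular x y) :
    formVal W = localVal (.some x y h) := by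
  rw [formVal, localVal]
  congr 1
  funext j
  rw [localCoord_some, genericCoords_eq]

lemma ordAt_algebraMap_nonneg {x y : k} (h : W.Nonsingular x y) (r : W.CoordinateRing) :
    0 ≤ ordAt (.some x y h) (algebraMap W.CoordinateRing W.FunctionField r) := by
  by_cases hr : algebraMap W.CoordinateRing W.FunctionField r = 0
  · simp [hr, ordAt, Subring.order_zero]
  refine (ordAt_nonneg_iff _ hr).2 ?_
  obtain ⟨A, rfl⟩ := formClass_surjective r
  rw [algebraMap_formClass, formVal_eq_localVal_some h]
  exact localVal_mem _ _

section

variable [IsAlgClosed k] [CharZero k] [W.IsElliptic]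

lemma exists_hasDivisor_xCoord_sub (c : k) :
    ∃ D, HasDivisor (xCoord W - algebraMap k _ c) D := by
  obtain ⟨y, hy⟩ := exists_nonsingular (W := W) c
  exact ⟨_, fun P => ordAt_xCoord_sub P hy, by simp⟩

lemma exists_hasDivisor_aeval {p : k[X]} (hp : p ≠ 0) :
    aeval (xCoord W) p ≠ 0 ∧ ∃ D, HasDivisor (aeval (xCoord W) p) D := by
  have h := (IsAlgClosed.splits p).eq_prod_roots
  have h0 : algebraMap k W.FunctionField p.leadingCoeff ≠ 0 := by simpa using hp
  have key : ∀ s : Multiset k,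
      aeval (xCoord W) (s.map fun a => X - C a).prod ≠ 0 ∧
        ∃ D, HasDivisor (aeval (xCoord W) (s.map fun a => X - C a).prod) D := by
    intro s
    induction s using Multiset.induction_on with
    | empty => simpa using ⟨0, by simpa using hasDivisor_const (W := W) 1⟩
    | cons a s ih =>
      obtain ⟨h1, D, hD⟩ := ih
      obtain ⟨D', hD'⟩ := exists_hasDivisor_xCoord_sub (W := W) a
      have ha := xCoord_sub_ne_zero (W := W) a
      rw [Multiset.map_cons, Multiset.prod_cons, map_mul, map_sub, aeval_X, aeval_C]
      exact ⟨mul_ne_zero ha h1, _, hD'.mul ha h1 hD⟩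
  obtain ⟨h1, D, hD⟩ := key p.roots
  rw [h, map_mul, aeval_C]
  exact ⟨mul_ne_zero h0 h1, _, (hasDivisor_const _).mul h0 h1 hD⟩

/-- The product of r with its conjugate is a polynomial in x, a product of factors x - c and a
constant, so its divisor has degree zero. Negation carries the divisor of r to that of the
conjugate, with the same degree, whence 2 deg(div r) = 0. -/
lemma exists_hasDivisor_algebraMap {r : W.CoordinateRing} (hr : r ≠ 0) :
    ∃ D, HasDivisor (algebraMap W.CoordinateRing W.FunctionField r) D := by
  have hinj := IsFractionRing.injective W.CoordinateRing W.FunctionField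
  have hr0 : algebraMap W.CoordinateRing W.FunctionField r ≠ 0 := (map_ne_zero_iff _ hinj).2 hr
  have hr1 : algebraMap W.CoordinateRing W.FunctionField (negRing W r) ≠ 0 :=
    (map_ne_zero_iff _ hinj).2 ((map_ne_zero_iff _ (negRing_injective W)).2 hr)
  have hnorm := congrArg (algebraMap W.CoordinateRing W.FunctionField) (mul_negRing W r)
  rw [algebraMap_mk_C, map_mul] at hnorm
  have hp : Algebra.norm k[X] r ≠ 0 := by
    intro h
    rw [h, map_zero] at hnorm
    exact mul_ne_zero hr0 hr1 hnorm
  obtain ⟨-, N, hN⟩ := exists_hasDivisor_aeval (W := W) hp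
  rw [← hnorm] at hN
  have hadd : ∀ P, ordAt P (algebraMap W.CoordinateRing W.FunctionField r) +
      ordAt P (algebraMap W.CoordinateRing W.FunctionField (negRing W r)) = N P := fun P => by
    rw [← ordAt_mul P hr0 hr1, hN.1]
  -- At affine points r and its conjugate both have nonnegative order, so r can vanish only where
  -- the norm does.
  have hfin : (Function.support fun P =>
      ordAt P (algebraMap W.CoordinateRing W.FunctionField r)).Finite := by
    refine (N.hasFiniteSupport.union (Set.finite_singleton (.zero : W.Point))).subset fun P hP => ?_
    rcases P with _ | ⟨x, y, h⟩
    · exact Or.inr rfl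
    · left
      have h1 := ordAt_algebraMap_nonneg h r
      have h2 := ordAt_algebraMap_nonneg h (negRing W r)
      have h3 := hadd (.some x y h)
      rw [Function.mem_support] at hP ⊢
      omega
  refine ⟨Finsupp.ofSupportFinite _ hfin, fun P => rfl, ?_⟩
  set D := Finsupp.ofSupportFinite _ hfin with hD
  have h1 : D + D.mapDomain (fun P => -P) = N := by
    ext P
    have h2 := Finsupp.mapDomain_apply (f := fun P : W.Point => -P) neg_injective D (-P)
    rw [neg_neg] at h2
    rw [Finsupp.add_apply, h2, ← hadd]
    congr 1
    change ordAt (-P) (algebraMap W.CoordinateRing W.FunctionField r) = _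
    have h3 := ordAt_neg_negField (-P) (algebraMap W.CoordinateRing W.FunctionField r)
    rw [neg_neg, negField_algebraMap] at h3
    exact h3.symm
  have h2 := congrArg Finsupp.degree h1
  rw [map_add, Finsupp.degree_mapDomain, hN.2] at h2
  omega

lemma exists_hasDivisor (f : W.FunctionField) : ∃ D, HasDivisor f D := by
  obtain ⟨r, s, hs, rfl⟩ := IsFractionRing.div_surjective (A := W.CoordinateRing) f
  by_cases hr : r = 0
  · rw [hr, map_zero, zero_div, ← map_zero (algebraMap k W.FunctionField)]
    exact ⟨0, hasDivisor_const 0⟩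
  have hs0 := nonZeroDivisors.ne_zero hs
  have hinj := IsFractionRing.injective W.CoordinateRing W.FunctionField
  obtain ⟨D, hD⟩ := exists_hasDivisor_algebraMap hr
  obtain ⟨D', hD'⟩ := exists_hasDivisor_algebraMap hs0
  rw [div_eq_mul_inv]
  exact ⟨_, hD.mul ((map_ne_zero_iff _ hinj).2 hr) (inv_ne_zero ((map_ne_zero_iff _ hinj).2 hs0))
    hD'.inv⟩

lemma finite_support_ordAt (f : W.FunctionField) : (Function.support fun P => ordAt P f).Finite := by
  obtain ⟨D, hD⟩ := exists_hasDivisor f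
  simp only [hD.1]
  exact D.hasFiniteSupport

variable (W) in
/-- The orders of vanishing of the functions on an elliptic curve. -/
noncomputable def orderSystem : OrderSystem k W.FunctionField W.Point where
  ord := ordAt
  ord_mul P _ _ hf hg := ordAt_mul P hf hg
  min_le_ord_add P _ _ hf hg hfg := min_le_ordAt_add P hf hg hfg
  ord_algebraMap := ordAt_algebraMap
  finite_support := finite_support_ordAt
  degree_eq_zero f := by
    obtain ⟨D, hD⟩ := exists_hasDivisor f
    rw [← hD.2]
    congr 1
    ext P
    exact hD.1 P
  exists_residue P _ hf h := (isUniformizer P).exists_pos_order_sub hf h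

lemma orderSystem_ord (P : W.Point) (f : W.FunctionField) : (orderSystem W).ord P f = ordAt P f :=
  rfl

/-- Multiplicities by length are the positive parts of the orders, so each finite partial sum is at
most the degree of the divisor of zeros. This inequality alone transfers the generating set. -/
lemma degree_le_degree_zeros {f : W.FunctionField} (hf : f ≠ 0) :
    degree W f ≤ (((orderSystem W).zeros f).degree.toNat : ℕ∞) := by
  refine iSup_le fun s => ?_
  have h1 : ∀ P, zeroMult W f P = ((((orderSystem W).zeros f) P).toNat : ℕ∞) := fun P => by
    rw [zeroMult, OrderSystem.zeros_apply, orderSystem_ord]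
    split_ifs with h
    · have := (ordAt_nonneg_iff P hf).2 h
      rw [(isUniformizer P).ringOrd_eq h hf]
      change ((ordAt P f).toNat : ℕ∞) = _
      rw [max_eq_left this]
    · have := mt (ordAt_nonneg_iff P hf).1 h
      rw [max_eq_right (by omega)]
      rfl
  simp only [h1]
  rw [← Nat.cast_sum, Nat.cast_le, Int.le_toNat
    (Finsupp.degree_nonneg_of_nonneg fun P => OrderSystem.zeros_apply (orderSystem W) f P ▸
      le_max_right _ _)]
  push_cast
  have h2 : ∀ P, (((orderSystem W).zeros f P).toNat : ℤ) = (orderSystem W).zeros f P := fun P => by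
    simp
  simp only [h2]
  classical
  rw [Finsupp.degree_apply]
  refine (Finset.sum_le_sum_of_subset_of_nonneg (Finset.subset_union_left
    (s₂ := ((orderSystem W).zeros f).support)) fun P _ _ => by simp).trans_eq ?_
  refine (Finset.sum_subset Finset.subset_union_right fun P _ hP => ?_).symm
  exact Finsupp.notMem_support_iff.1 hP

end

end EllDegree

/-! ### Functions with poles only at infinity, and genus one -/

namespace EllDegree

open WeierstrassCurve Polynomial

variable {k : Type*} [Field k] {W : Affine k}

/-- The Nullstellensatz for the affine coordinate ring. -/
lemma exists_equation_of_isMaximal [IsAlgClosed k] (M : Ideal W.CoordinateRing)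
    (hM : M.IsMaximal) : ∃ x y : k, W.Equation x y ∧
      ∀ A, formClass W A ∈ M → MvPolynomial.eval ![x, y, 1] A = 0 := by
  let _ := Ideal.Quotient.field M
  have hft : Algebra.FiniteType k (W.CoordinateRing ⧸ M) :=
    Algebra.FiniteType.of_surjective ((Ideal.Quotient.mkₐ k M).comp (MvPolynomial.aeval
        ![Affine.CoordinateRing.mk W (C X), Affine.CoordinateRing.mk W X, 1]))
      ((Ideal.Quotient.mkₐ_surjective k M).comp formClass_surjective)
  -- By Zariski's lemma the residue field is finite over k, hence equal to k; the images of x and y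
  -- are the coordinates of the point.
  have hfin : Module.Finite k (W.CoordinateRing ⧸ M) :=
    finite_of_finite_type_of_isJacobsonRing k (W.CoordinateRing ⧸ M)
  have hbij : Function.Bijective (algebraMap k (W.CoordinateRing ⧸ M)) :=
    IsAlgClosed.algebraMap_bijective_of_isIntegral
  obtain ⟨x, hx⟩ := hbij.2 (Ideal.Quotient.mk M (Affine.CoordinateRing.mk W (C X)))
  obtain ⟨y, hy⟩ := hbij.2 (Ideal.Quotient.mk M (Affine.CoordinateRing.mk W X))
  have hc : ∀ c : k, algebraMap k (W.CoordinateRing ⧸ M) c =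
      Ideal.Quotient.mk M (Affine.CoordinateRing.mk W (C (C c))) := fun _ => rfl
  refine ⟨x, y, ?_, fun A hA => ?_⟩
  · have h : Affine.CoordinateRing.mk W W.polynomial = 0 := AdjoinRoot.mk_self
    rw [Affine.equation_iff]
    refine hbij.1 ?_
    have h' := congrArg (Ideal.Quotient.mk M) h
    simp only [Affine.polynomial, map_sub, map_add, map_mul, map_pow, map_zero] at h'
    simp only [map_add, map_mul, map_pow, hx, hy, hc W.a₁, hc W.a₂, hc W.a₃, hc W.a₄, hc W.a₆]
    linear_combination h'
  · have h : (Ideal.Quotient.mk M).comp (formClass W) =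
        (algebraMap k (W.CoordinateRing ⧸ M)).comp (MvPolynomial.eval ![x, y, 1]) := by
      refine MvPolynomial.ringHom_ext (fun c => ?_) fun i => ?_
      · simp only [RingHom.comp_apply, formClass, MvPolynomial.eval₂Hom_C, MvPolynomial.eval_C]
        rfl
      · fin_cases i <;> simp [formClass, hx, hy]
    have h' := RingHom.congr_fun h A
    rw [RingHom.comp_apply, Ideal.Quotient.eq_zero_iff_mem.2 hA] at h'
    exact hbij.1 (by rw [map_zero]; exact h'.symm)

/-- A function without poles on the affine curve is a polynomial in the coordinates. -/
lemma exists_algebraMap_eq [IsAlgClosed k] [W.IsElliptic] {f : W.FunctionField}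
    (hf : ∀ x y h, f ∈ localRing W (.some x y h)) :
    ∃ r, algebraMap W.CoordinateRing W.FunctionField r = f := by
  let I : Ideal W.CoordinateRing :=
    { carrier := {r | ∃ s, algebraMap W.CoordinateRing W.FunctionField s =
        algebraMap W.CoordinateRing W.FunctionField r * f}
      add_mem' := by
        rintro a b ⟨s, hs⟩ ⟨t, ht⟩
        exact ⟨s + t, by rw [map_add, map_add, hs, ht, add_mul]⟩
      zero_mem' := ⟨0, by simp⟩
      smul_mem' := by
        rintro c a ⟨s, hs⟩
        exact ⟨c * s, by rw [smul_eq_mul, map_mul, map_mul, hs, mul_assoc]⟩ }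
  by_cases hI : I = ⊤
  · obtain ⟨s, hs⟩ := (Ideal.eq_top_iff_one I).1 hI
    exact ⟨s, by rw [hs, map_one, one_mul]⟩
  obtain ⟨M, hM, hIM⟩ := Ideal.exists_le_maximal I hI
  obtain ⟨x, y, h, hxy⟩ := exists_equation_of_isMaximal M hM
  have hP := Affine.equation_iff_nonsingular.1 h
  obtain ⟨a, b, hb, e⟩ := mem_localRing_iff.1 (hf x y hP)
  have hb0 := localVal_ne_zero hb
  refine absurd (hxy b (hIM ⟨formClass W a, ?_⟩)) hb
  rw [algebraMap_formClass, algebraMap_formClass, formVal_eq_localVal_some hP, e,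
    mul_div_cancel₀ _ hb0]

lemma algebraMap_smul_basis (p q : k[X]) : algebraMap W.CoordinateRing W.FunctionField
    (p • 1 + q • Affine.CoordinateRing.mk W X) =
      aeval (xCoord W) p + aeval (xCoord W) q * yCoord W := by
  rw [map_add, Affine.CoordinateRing.smul, Affine.CoordinateRing.smul, mul_one, map_mul,
    algebraMap_mk_C, algebraMap_mk_C, yCoord]

/-- There is a function with divisor `(P) + (-P) - 2(O)`. -/
lemma exists_ordAt_eq (P : W.Point) : ∃ h : W.FunctionField, h ≠ 0 ∧ ∀ Q, ordAt Q h =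
    (Finsupp.single P 1 + Finsupp.single (-P) 1 - Finsupp.single .zero 2 : W.Point →₀ ℤ) Q := by
  rcases P with _ | ⟨x, y, hP⟩
  · refine ⟨algebraMap k _ 1, by simp, fun Q => ?_⟩
    have : (-.zero : W.Point) = .zero := rfl
    rw [ordAt_algebraMap, this, ← Finsupp.single_add]
    simp
  · exact ⟨_, xCoord_sub_ne_zero x, fun Q => ordAt_xCoord_sub Q hP⟩

lemma ordAt_zero_aeval [IsAlgClosed k] {p : k[X]} (hp : p ≠ 0) :
    ordAt (.zero : W.Point) (aeval (xCoord W) p) = -2 * p.natDegree := by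
  have h := (IsAlgClosed.splits p).eq_prod_roots
  have h0 : algebraMap k W.FunctionField p.leadingCoeff ≠ 0 := by simpa using hp
  have key : ∀ s : Multiset k,
      aeval (xCoord W) (s.map fun a => X - C a).prod ≠ 0 ∧
        ordAt (.zero : W.Point) (aeval (xCoord W) (s.map fun a => X - C a).prod) =
          -2 * s.card := by
    intro s
    induction s using Multiset.induction_on with
    | empty => simpa using ordAt_algebraMap (.zero : W.Point) 1
    | cons a s ih =>
      obtain ⟨h1, h2⟩ := ih
      have ha := xCoord_sub_ne_zero (W := W) a
      rw [Multiset.map_cons, Multiset.prod_cons, map_mul, map_sub, aeval_X, aeval_C]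
      refine ⟨mul_ne_zero ha h1, ?_⟩
      rw [ordAt_mul _ ha h1, ordAt_zero_xCoord_sub, h2, Multiset.card_cons]
      push_cast
      ring
  obtain ⟨h1, h2⟩ := key p.roots
  rw [(IsAlgClosed.splits p).natDegree_eq_card_roots, ← h2]
  conv_lhs => rw [h]
  rw [map_mul, aeval_C, ordAt_mul _ h0 h1, ordAt_algebraMap, zero_add]

/-- The point O is fixed by negation, so r and its conjugate have equal order there. Twice this
order is that of the norm, a polynomial in x, and x has a double pole. -/
lemma ordAt_zero_algebraMap [IsAlgClosed k] {r : W.CoordinateRing} (hr : r ≠ 0) :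
    ordAt (.zero : W.Point) (algebraMap W.CoordinateRing W.FunctionField r) =
      -(Algebra.norm k[X] r).natDegree := by
  have hinj := IsFractionRing.injective W.CoordinateRing W.FunctionField
  have hr0 : algebraMap W.CoordinateRing W.FunctionField r ≠ 0 :=
    (_root_.map_ne_zero_iff _ hinj).2 hr
  have hr1 : algebraMap W.CoordinateRing W.FunctionField (negRing W r) ≠ 0 :=
    (_root_.map_ne_zero_iff _ hinj).2 ((_root_.map_ne_zero_iff _ (negRing_injective W)).2 hr)
  have hnorm := congrArg (algebraMap W.CoordinateRing W.FunctionField) (mul_negRing W r)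
  rw [algebraMap_mk_C, map_mul] at hnorm
  have hp : Algebra.norm k[X] r ≠ 0 := by
    intro h
    rw [h, map_zero] at hnorm
    exact mul_ne_zero hr0 hr1 hnorm
  have h1 := ordAt_zero_aeval (W := W) hp
  have h2 := ordAt_neg_negField (.zero : W.Point)
    (algebraMap W.CoordinateRing W.FunctionField r)
  rw [negField_algebraMap] at h2
  change ordAt (.zero : W.Point) _ = _ at h2
  rw [← hnorm, ordAt_mul _ hr0 hr1, h2] at h1
  omega

section

variable [IsAlgClosed k] [CharZero k] [W.IsElliptic]

/-- With no affine poles f lies in the coordinate ring, and its pole order at O is the degree of the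
norm of p + qy. -/
lemma exists_eq_of_mem_space {n : ℕ} {f : W.FunctionField}
    (hf : f ∈ (orderSystem W).space (.single .zero (n : ℤ))) : ∃ p q : k[X],
      f = aeval (xCoord W) p + aeval (xCoord W) q * yCoord W ∧
        max (2 • p.degree) (2 • q.degree + 3) ≤ n := by
  classical
  obtain ⟨r, rfl⟩ := exists_algebraMap_eq (f := f) fun x y h => by
    by_cases hf0 : f = 0
    · rw [hf0]
      exact zero_mem _
    have := hf (.some x y h) hf0
    rw [Finsupp.single_eq_of_ne (by simp), neg_zero] at this
    exact (ordAt_nonneg_iff _ hf0).1 this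
  obtain ⟨p, q, hr⟩ := Affine.CoordinateRing.exists_smul_basis_eq r
  refine ⟨p, q, by rw [← algebraMap_smul_basis, hr], ?_⟩
  by_cases h0 : r = 0
  · obtain ⟨hp, hq⟩ := Affine.CoordinateRing.smul_basis_eq_zero (hr.trans h0)
    simp [hp, hq]
  rw [← Affine.CoordinateRing.degree_norm_smul_basis p q, hr]
  have h1 := hf .zero ((_root_.map_ne_zero_iff _
    (IsFractionRing.injective W.CoordinateRing W.FunctionField)).2 h0)
  rw [Finsupp.single_eq_same, orderSystem_ord, ordAt_zero_algebraMap h0] at h1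
  exact degree_le_of_natDegree_le (by omega)

lemma exists_eq_of_mem_space_two {f : W.FunctionField}
    (hf : f ∈ (orderSystem W).space (.single .zero 2)) :
    ∃ a b : k, f = algebraMap k _ a + algebraMap k _ b * xCoord W := by
  obtain ⟨p, q, rfl, h⟩ := exists_eq_of_mem_space (n := 2) (by exact_mod_cast hf)
  obtain ⟨h1, h2⟩ := max_le_iff.1 h
  have hq : q = 0 := by
    by_contra hq
    rw [degree_eq_natDegree hq] at h2
    norm_cast at h2
  have hp : p.degree ≤ 1 := by
    by_cases hp : p = 0
    · simp [hp]
    rw [degree_eq_natDegree hp] at h1 ⊢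
    rw [nsmul_eq_mul] at h1
    norm_cast at h1 ⊢
    omega
  refine ⟨p.coeff 0, p.coeff 1, ?_⟩
  conv_lhs => rw [hq, eq_X_add_C_of_degree_le_one hp]
  simp [add_comm]

lemma mem_space_of_le_ordAt_zero {n : ℤ} {r : W.CoordinateRing}
    (h : -n ≤ ordAt (.zero : W.Point) (algebraMap W.CoordinateRing W.FunctionField r)) :
    algebraMap W.CoordinateRing W.FunctionField r ∈ (orderSystem W).space (.single .zero n) := by
  classical
  rintro (_ | ⟨x, y, hP⟩) -
  · rw [Finsupp.single_eq_same]
    exact h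
  · rw [Finsupp.single_eq_of_ne (by simp), neg_zero]
    exact ordAt_algebraMap_nonneg hP r

/-- The functions 1, x, y, x² lie in L(4O) and are linearly independent. -/
lemma four_le_of_space_le (s : Finset W.FunctionField)
    (hs : (orderSystem W).space (.single .zero 4) ≤ Submodule.span k s) : 4 ≤ s.card := by
  have hx := xCoord_ne_zero (W := W)
  let v : Fin 4 → W.FunctionField := ![1, xCoord W, yCoord W, xCoord W ^ 2]
  have hv : LinearIndependent k v := by
    rw [Fintype.linearIndependent_iff]
    intro c hc
    have h0 : algebraMap W.CoordinateRing W.FunctionField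
        ((C (c 0) + C (c 1) * X + C (c 3) * X ^ 2) • 1 +
          C (c 2) • Affine.CoordinateRing.mk W X) = 0 := by
      rw [algebraMap_smul_basis, ← hc, Fin.sum_univ_four]
      simp only [v, Algebra.smul_def, map_add, map_mul, aeval_C, aeval_X, map_pow]
      simp
      ring
    obtain ⟨hp, hq⟩ := Affine.CoordinateRing.smul_basis_eq_zero
      ((map_eq_zero_iff _ (IsFractionRing.injective W.CoordinateRing W.FunctionField)).1 h0)
    have h1 := congrArg (coeff · 0) hp
    have h2 := congrArg (coeff · 1) hp
    have h3 := congrArg (coeff · 2) hp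
    have h4 : c 2 = 0 := by simpa using hq
    simp [coeff_X, coeff_C] at h1 h2 h3
    intro i
    fin_cases i <;> assumption
  have hmem : ∀ i, v i ∈ Submodule.span k (s : Set W.FunctionField) := by
    intro i
    refine hs ?_
    fin_cases i
    · change (1 : W.FunctionField) ∈ _
      rw [← map_one (algebraMap W.CoordinateRing W.FunctionField)]
      refine mem_space_of_le_ordAt_zero ?_
      rw [map_one, ← map_one (algebraMap k W.FunctionField), ordAt_algebraMap]
      omega
    · exact mem_space_of_le_ordAt_zero (by
        change _ ≤ ordAt _ (xCoord W); rw [ordAt_zero_xCoord]; omega)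
    · exact mem_space_of_le_ordAt_zero (by
        change _ ≤ ordAt _ (yCoord W); rw [ordAt_zero_yCoord]; omega)
    · change xCoord W ^ 2 ∈ _
      rw [xCoord, ← map_pow]
      refine mem_space_of_le_ordAt_zero ?_
      rw [map_pow]
      change _ ≤ ordAt _ (xCoord W ^ 2)
      rw [pow_two, ordAt_mul _ hx hx, ordAt_zero_xCoord]
      omega
  have h1 := finrank_span_eq_card hv
  rw [Fintype.card_fin] at h1
  rw [← h1]
  exact (Submodule.finrank_mono (Submodule.span_le.2 (Set.range_subset_iff.2 hmem))).trans
    (finrank_span_finset_le_card s)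

variable (W) in
lemma isGenusOne : (orderSystem W).IsGenusOne where
  mem_range_of_simple_pole P f hf := by
    classical
    rcases P with _ | ⟨x, y, hP⟩
    · obtain ⟨a, b, rfl⟩ := exists_eq_of_mem_space_two ((orderSystem W).space_mono (fun Q => by
        rw [Finsupp.single_apply, Finsupp.single_apply]
        split_ifs <;> norm_num) hf)
      by_cases hb : b = 0
      · exact ⟨a, by rw [hb, map_zero, zero_mul, add_zero]⟩
      have h0 := xCoord_sub_ne_zero (W := W) (-(a / b))
      have hb' : algebraMap k W.FunctionField b ≠ 0 := by simpa using hb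
      have e : algebraMap k W.FunctionField a + algebraMap k _ b * xCoord W =
          algebraMap k _ b * (xCoord W - algebraMap k _ (-(a / b))) := by
        rw [map_neg, map_div₀]
        field_simp
        ring
      rw [e] at hf
      have := hf .zero (mul_ne_zero hb' h0)
      rw [orderSystem_ord, ordAt_mul _ hb' h0, ordAt_algebraMap, ordAt_zero_xCoord_sub,
        Finsupp.single_eq_same] at this
      omega
    · have h0 := xCoord_sub_ne_zero (W := W) x
      -- The factor x - x(P) removes the pole at P at the cost of a double pole at O, and L(2O) is
      -- spanned by 1 and x.
      obtain ⟨a, b, hab⟩ := exists_eq_of_mem_space_two (W := W)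
        (f := f * (xCoord W - algebraMap k _ x)) fun Q hQ => by
          have hf0 := left_ne_zero_of_mul hQ
          have h1 := hf Q hf0
          rw [orderSystem_ord] at h1 ⊢
          rw [ordAt_mul _ hf0 h0, ordAt_xCoord_sub Q hP, Finsupp.sub_apply, Finsupp.add_apply]
          have h2 := Finsupp.single_one_apply_nonneg (-.some x y hP) Q
          omega
      have e : f - algebraMap k _ b =
          algebraMap k _ (a + b * x) * (xCoord W - algebraMap k _ x)⁻¹ := by
        rw [eq_mul_inv_iff_mul_eq₀ h0, sub_mul, hab, map_add, map_mul]
        ring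
      by_cases hc : a + b * x = 0
      · rw [hc, map_zero, zero_mul, sub_eq_zero] at e
        exact ⟨b, e.symm⟩
      have hc' : algebraMap k W.FunctionField (a + b * x) ≠ 0 := by
        rwa [Ne, FaithfulSMul.algebraMap_eq_zero_iff]
      have hmem : f - algebraMap k _ b ∈ (orderSystem W).space (.single (.some x y hP) 1) :=
        sub_mem hf fun Q hQ => ((orderSystem W).vanishes_const Q b).mono (by
          have h2 := Finsupp.single_one_apply_nonneg (.some x y hP) Q
          omega) hQ
      rw [e] at hmem
      -- The function (x - x(P))⁻¹ has order -1 at -P, or -2 if P = -P, one less than L(P) permits.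
      have h1 := hmem (-.some x y hP) (mul_ne_zero hc' (inv_ne_zero h0))
      rw [orderSystem_ord, ordAt_mul _ hc' (inv_ne_zero h0), ordAt_algebraMap, ordAt_inv,
        ordAt_xCoord_sub _ hP, Finsupp.sub_apply, Finsupp.add_apply,
        Finsupp.single_eq_same (a := -Affine.Point.some x y hP),
        Finsupp.single_eq_of_ne (a' := -Affine.Point.some x y hP) (a := .zero) (by
          rw [Affine.Point.neg_some]; simp)] at h1
      omega
  exists_mem_space_single_add_single P Q := by
    by_contra! hcon
    obtain ⟨u, hu, hu'⟩ := exists_ordAt_eq P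
    obtain ⟨v, hv, hv'⟩ := exists_ordAt_eq Q
    have huv := mul_ne_zero hu hv
    set D : W.Point →₀ ℤ := .single .zero 4 - .single (-P) 1 - .single (-Q) 1 with hD
    -- The divisor of uv is (P) + (-P) + (Q) + (-Q) - 4(O), so division by uv maps L(D) into L(P +
    -- Q), which is assumed to contain constants only.
    have h1 : (orderSystem W).space D ≤ Submodule.span k {u * v} := by
      intro f hf
      obtain ⟨c, hc⟩ := hcon (f / (u * v)) fun R hR => by
        have hf0 : f ≠ 0 := fun h => hR (by rw [h, zero_div])
        have h2 := hf R hf0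
        rw [(orderSystem W).ord_div _ hf0 huv]
        rw [orderSystem_ord, orderSystem_ord, ordAt_mul _ hu hv, hu', hv']
        rw [orderSystem_ord, hD] at h2
        have e : (Finsupp.single .zero 4 : W.Point →₀ ℤ) =
          .single .zero 2 + .single .zero 2 := by rw [← Finsupp.single_add]; rfl
        rw [e] at h2
        simp only [Finsupp.add_apply, Finsupp.sub_apply] at h2 ⊢
        omega
      refine Submodule.mem_span_singleton.2 ⟨c, ?_⟩
      rw [Algebra.smul_def, hc, div_mul_cancel₀ _ huv]
    obtain ⟨g, hg⟩ := (orderSystem W).space_add_single_le D (-P)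
    obtain ⟨g', hg'⟩ := (orderSystem W).space_add_single_le (D + .single (-P) 1) (-Q)
    have e : D + .single (-P) 1 + .single (-Q) 1 = .single .zero 4 := by
      rw [hD]
      abel
    rw [e] at hg'
    classical
    -- Restoring the points -P and -Q adds at most two generators to the one of L(D), so L(4O) would
    -- be spanned by three functions.
    have h3 := four_le_of_space_le (W := W) ({u * v, g, g'} : Finset W.FunctionField) (by
      refine hg'.trans (sup_le ((hg.trans (sup_le (h1.trans ?_) ?_))) ?_) <;>
      exact Submodule.span_mono (by simp))
    have := Finset.card_le_three (a := u * v) (b := g) (c := g')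
    omega

end

end EllDegree

theorem theorem2 {k : Type*} [Field k] [IsAlgClosed k] [CharZero k]
    (E : WeierstrassCurve k) [E.IsElliptic] :
    AddSubgroup.closure
      {b : PreBloch.B₂ E.toAffine.FunctionField |
        ∃ f : PreBloch.Gen E.toAffine.FunctionField,
          EllDegree.degree E.toAffine f.1 ≤ 3 ∧ b = PreBloch.cls f} = ⊤ := by
  have : WeierstrassCurve.IsElliptic E.toAffine := ‹E.IsElliptic›
  rw [eq_top_iff, ← (EllDegree.isGenusOne E.toAffine).closure_eq_top]
  refine AddSubgroup.closure_mono ?_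
  rintro b ⟨f, hf, rfl⟩
  refine ⟨f, (EllDegree.degree_le_degree_zeros f.2.1).trans ?_, rfl⟩
  exact_mod_cast Int.toNat_le.2 hf
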